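/- **Setting.** Let $G$ be a finite polygon decomposition of the (oriented) torus, with sets of vertices $\mathcal G_0$, oriented edges $\mathcal G_1$ and faces $\mathcal G_2$, in which every edge lies between two different vertices and between two different faces. The dual edge $e^*$ crosses $e$ from right to left, leading from the face on the right of $e$ to the face on its left. Let $d\ge 1$, $\omega=e^{2\pi \mathrm i/d}$, and let $\mathcal H_G=\bigotimes_{e\in\mathcal G_1}\mathbb C^d$. On $\mathbb C^d$ with orthonormal basis $(l_i)_{i\in\mathbb Z_d}$ let $Xl_i=l_{i+1}$ and $Zl_i=\omega^i l_i$. For a $1$-chain $\gamma=\sum_e c_e e$ and a $1$-cochain (chain of dual edges) $\gamma^*=\sum_e c^*_{e}e^*$ with coefficients in $\mathbb Z_d$ put $Z_\gamma=\prod_e Z_e^{c_e}$ and $X_{\gamma^*}=\prod_e X_e^{c^*_e}$. For a vertex $v$ let $a_v$ be the product of $X_e$ over the edges coming into $v$ and of $X_e^{-1}$ over the edges going out of $v$; for a face $f$ let $b_f=Z_{\partial f}$. Let $A_v=\frac1d\sum_{j=0}^{d-1}a_v^j$, $B_f=\frac1d\sum_{j=0}^{d-1}b_f^j$ and $H_G=-\sum_vA_v-\sum_fB_f$,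 and let $\mathcal S_G$ be the ground state space of $H_G$, i.e. the eigenspace of its smallest eigenvalue. A walk (sequence of consecutive edges, each run through in either direction) is identified with the $1$-chain that is the signed sum of its edges; a cowalk from a face to a face is a walk in the dual decomposition, identified with a $1$-cochain. Let $\lambda,\tau_0$ be integral cycles whose classes form a basis of $H_1(G;\mathbb Z)$ and $\lambda^*,\tau_0^*$ integral cocycles whose classes form a basis of the first homology of the dual decomposition, such that, for the algebraic crossing number $\langle c,c^*\rangle=\sum_e c_ec^*_e$, one has $\langle\lambda,\lambda^*\rangle=\langle\tau_0,\tau_0^*\rangle=0$, $\langle\lambda,\tau_0^*\rangle>0$ and $\langle\tau_0,\lambda^*\rangle>0$. We call these elementary (co)cycles. Let $Z_{0,1}$ denote $Z_c$ for any $\mathbb Z_d$-cycle $c$ homologous to $\tau_0$ modulo $d$, and $X_{1,0}$ denote $X_{c^*}$ for any $\mathbb Z_d$-cocycle $c^*$ cohomologous to $\lambda^*$ modulo $d$. For a vertex $v$ and a cowalk $\gamma^*$ from a face $f$ to a face $\tilde f$, a *braiding loop* is a closed walk $\tau$ from $v$ to $v$ that is a boundary (over $\mathbb Z_d$) and has a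 single edge in common with $\gamma^*$ (as $\mathbb Z_d$-chains), where $\gamma^*$ crosses $\tau$ once, from left to right, i.e. $\tau$ runs counterclockwise around $f$: the product of the two coefficients at this edge is $-1$. The corresponding physical braiding of the $Z$-particle at $v$ around the $X$-particle at $f$ is $B\varphi=Z_\tau\varphi$. **Theorem.** Let $v\ne\tilde v$ be vertices and $f\ne\tilde f$ faces of $G$, let $0\neq\Psi\in\mathcal S_G$, and let $$\mathcal V_{XZ}=\mathrm{span}\{X_{\gamma^*}Z_\gamma\Psi:\ \gamma\text{ a walk from }v\text{ to }\tilde v,\ \gamma^*\text{ a cowalk from }f\text{ to }\tilde f\}.$$ 1. $\mathcal V_{XZ}=X_{\gamma^*}Z_\gamma\mathcal S_G$ for every walk $\gamma$ from $v$ to $\tilde v$ and every cowalk $\gamma^*$ from $f$ to $\tilde f$. In particular, (a) $\dim\mathcal V_{XZ}=\dim\mathcal S_G$, and (b) $\mathcal V_{XZ}$ does not depend on the choice of $0\ne\Psi\in\mathcal S_G$. 2. Elementary (co)cycles exist, and for every cowalk $\gamma^*$ from $f$ to $\tilde f$ that visits no face twice there is a braiding loop at $v$. For every cowalk $\gamma^*$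 from $f$ to $\tilde f$, every braiding loop $\tau$ at $v$ for $\gamma^*$, every choice of elementary (co)cycles and of the representatives defining $X_{1,0}$ and $Z_{0,1}$, and every $\varphi\in\mathcal V_{XZ}$, $$B\varphi=\left(X_{1,0}Z_{0,1}X_{1,0}^{-1}Z_{0,1}^{-1}\right)\varphi\qquad\text{and}\qquad B\varphi=\omega^{-1}\varphi .$$ -/

import Mathlib

/-!
Kitaev's abelian (`ℤ/d`) models on a polygon decomposition of a closed connected oriented surface,
and the states with one particle-antiparticle pair of each of the two types.
-/

namespace Kitaev

/-! ### Polygon decompositions -/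

/-- The two directed versions of every edge: `(e, true)` is `e` with its fixed orientation and
`(e, false)` is `e` with the opposite orientation. -/
abbrev Dart (E : Type*) := E × Bool

/-- Orientation reversal of darts. -/
def flip (E : Type*) : Equiv.Perm (Dart E) :=
  (Equiv.refl E).prodCongr Equiv.boolNot

/-- A (finite) polygon decomposition, with edge set `E`, of a closed connected oriented surface,
encoded as usual by its rotation system. The permutation `rotation` sends a dart to the next dart,
counterclockwise, with the same initial vertex. The vertices are the cycles of `rotation`; the faces
are the cycles of `faceRotation`, which sends a dart to the next one on the boundary of the face to
its left. Every edge lies between two different vertices and between two different faces. -/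
structure PolygonDecomposition (E : Type*) where
  rotation : Equiv.Perm (Dart E)
  nonempty : Nonempty E
  connected : MulAction.IsPretransitive
    (Subgroup.closure ({rotation, flip E} : Set (Equiv.Perm (Dart E)))) (Dart E)
  ends_ne : ∀ e : E, ¬ rotation.SameCycle (e, true) (e, false)
  sides_ne : ∀ e : E, ¬ (rotation⁻¹ * flip E).SameCycle (e, true) (e, false)

namespace PolygonDecomposition

variable {E : Type*} (G : PolygonDecomposition E)

/-- Follow a dart to its end and then take the next dart clockwise: the next dart on the
(counterclockwise) boundary of the face on the left. -/
def faceRotation : Equiv.Perm (Dart E) := G.rotation⁻¹ * flip E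

def Vertex : Type _ := Quotient (Equiv.Perm.SameCycle.setoid G.rotation)

def Face : Type _ := Quotient (Equiv.Perm.SameCycle.setoid G.faceRotation)

instance [Finite E] : Finite G.Vertex :=
  inferInstanceAs (Finite (Quotient (Equiv.Perm.SameCycle.setoid G.rotation)))

instance [Finite E] : Finite G.Face :=
  inferInstanceAs (Finite (Quotient (Equiv.Perm.SameCycle.setoid G.faceRotation)))

noncomputable instance [Finite E] : Fintype G.Vertex := Fintype.ofFinite _

noncomputable instance [Finite E] : Fintype G.Face := Fintype.ofFinite _

/-- Initial vertex of a dart. -/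
def src (a : Dart E) : G.Vertex := Quotient.mk _ a

/-- Final vertex of a dart. -/
def tgt (a : Dart E) : G.Vertex := G.src (flip E a)

/-- The face on the left of a dart. -/
def left (a : Dart E) : G.Face := Quotient.mk _ a

/-- The face on the right of a dart. -/
def right (a : Dart E) : G.Face := G.left (flip E a)

/-- The surface has genus `g`: its Euler characteristic is `2 - 2g`. -/
def HasGenus (g : ℕ) : Prop :=
  (Nat.card G.Vertex : ℤ) - Nat.card E + Nat.card G.Face = 2 - 2 * g

/-! ### Chains, cochains, (co)cycles and (co)boundaries

Both `1`-chains and `1`-cochains (chains of dual edges) with coefficients in `R` are functions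
`E → R`. The dual edge `e*` crosses `e` from right to left, so that `(e, e*)` is positively
oriented. -/

section Chains

variable (R : Type*) [CommRing R]

open Classical in
/-- `+1` if `e` is incoming at `v`, `-1` if it is outgoing, `0` otherwise. -/
noncomputable def vertexSign (v : G.Vertex) (e : E) : R :=
  (if G.tgt (e, true) = v then 1 else 0) - (if G.src (e, true) = v then 1 else 0)

open Classical in
/-- `+1` if `e` is on the boundary of `f` with the positive orientation (`f` is on its left), `-1`
if it is so with the negative orientation, `0` otherwise. -/
noncomputable def faceSign (f : G.Face) (e : E) : R :=
  (if G.left (e, true) = f then 1 else 0) - (if G.right (e, true) = f then 1 else 0)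

variable [Fintype E]

/-- The boundary `∂₁` of `1`-chains. -/
noncomputable def bdry₁ : (E → R) →ₗ[R] (G.Vertex → R) where
  toFun c := fun v => ∑ e, c e * G.vertexSign R v e
  map_add' a b := by ext v; simp [add_mul, Finset.sum_add_distrib]
  map_smul' r a := by ext v; simp [Finset.mul_sum, mul_assoc]

/-- The boundary `∂₂` of `2`-chains. -/
noncomputable def bdry₂ : (G.Face → R) →ₗ[R] (E → R) where
  toFun c := fun e => ∑ f, c f * G.faceSign R f e
  map_add' a b := by ext e; simp [add_mul, Finset.sum_add_distrib]
  map_smul' r a := by ext e; simp [Finset.mul_sum, mul_assoc]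

/-- The boundary of chains of dual edges; `e*` goes from the face on the right of `e` to the face on
the left of `e`. -/
noncomputable def cobdry₁ : (E → R) →ₗ[R] (G.Face → R) where
  toFun c := fun f => ∑ e, c e * G.faceSign R f e
  map_add' a b := by ext v; simp [add_mul, Finset.sum_add_distrib]
  map_smul' r a := by ext v; simp [Finset.mul_sum, mul_assoc]

/-- The boundary of chains of dual faces, which correspond to the vertices. -/
noncomputable def cobdry₂ : (G.Vertex → R) →ₗ[R] (E → R) where
  toFun c := fun e => ∑ v, c v * G.vertexSign R v e
  map_add' a b := by ext e; simp [add_mul, Finset.sum_add_distrib]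
  map_smul' r a := by ext e; simp [Finset.mul_sum, mul_assoc]

end Chains

end PolygonDecomposition

/-- The algebraic number of crossings of a chain with a cochain. -/
def crossing {E R : Type*} [Fintype E] [CommRing R] (c s : E → R) : R := ∑ e, c e * s e

/-! ### Walks and cowalks -/

/-- Sequences of darts that match up, where a dart `a` leads from `s a` to `t a`. -/
inductive DartWalk {E A : Type*} (s t : Dart E → A) : A → A → Type _
  | nil (x : A) : DartWalk s t x x
  | cons {x y z : A} (a : Dart E) (hs : s a = x) (ht : t a = y) (p : DartWalk s t y z) :
      DartWalk s t x z

namespace DartWalk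

variable {E A : Type*} {s t : Dart E → A}

open Classical in
/-- The `1`-(co)chain of a (co)walk. -/
noncomputable def chain (R : Type*) [CommRing R] {x y : A} : DartWalk s t x y → (E → R)
  | nil _ => 0
  | cons a _ _ p => Pi.single a.1 (if a.2 = true then 1 else -1) + p.chain R

/-- The list of vertices (resp. faces) that a walk (resp. cowalk) visits. -/
def support {x y : A} : DartWalk s t x y → List A
  | nil x => [x]
  | cons (x := x) _ _ _ p => x :: p.support

end DartWalk

namespace PolygonDecomposition

variable {E : Type*} (G : PolygonDecomposition E)

abbrev Walk (v w : G.Vertex) := DartWalk G.src G.tgt v w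

/-- A step `a` of a cowalk runs through the dual edge of `a`, from the right of `a` to its left. -/
abbrev Cowalk (f g : G.Face) := DartWalk G.right G.left f g

end PolygonDecomposition

/-! ### The spin system -/

/-- `ω = exp(2πi/d)`. -/
noncomputable def omega (d : ℕ) : ℂ := Complex.exp (2 * Real.pi * Complex.I / d)

/-- `ω ^ a` for `a` in `ℤ/d`. -/
noncomputable def phase (d : ℕ) (a : ZMod d) : ℂ := omega d ^ a.val

theorem omega_pow_self (d : ℕ) [NeZero d] : omega d ^ d = 1 := by
  rw [omega, ← Complex.exp_nat_mul, mul_div_cancel₀ _ (Nat.cast_ne_zero.2 (NeZero.ne d)),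
    Complex.exp_two_pi_mul_I]

theorem phase_zero (d : ℕ) : phase d 0 = 1 := by simp [phase]

theorem phase_add (d : ℕ) [NeZero d] (a b : ZMod d) :
    phase d (a + b) = phase d a * phase d b := by
  rw [phase, phase, phase, ZMod.val_add, ← pow_add, ← pow_mod_orderOf,
    Nat.mod_mod_of_dvd _ (orderOf_dvd_of_pow_eq_one (omega_pow_self d)), pow_mod_orderOf]

section Operators

variable (E : Type*) [Fintype E] (d : ℕ)

/-- The tensor product over `e ∈ E` of the spaces `ℂ^d` with orthonormal bases `l_i`, `i ∈ ℤ/d`,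
written in the product basis `⨂ l_{k e}`, `k : E → ℤ/d`. -/
abbrev Hilb [NeZero d] := EuclideanSpace ℂ (E → ZMod d)

variable {E} [NeZero d]

/-- `X_{γ*} = ∏ X_e ^ {c_e}`, which maps `⨂ l_{k e}` to `⨂ l_{k e + c e}`. -/
def opX (c : E → ZMod d) : Hilb E d ≃ₗ[ℂ] Hilb E d where
  toFun ψ := WithLp.toLp 2 fun k => ψ (k - c)
  invFun ψ := WithLp.toLp 2 fun k => ψ (k + c)
  map_add' _ _ := by ext; simp
  map_smul' _ _ := by ext; simp
  left_inv _ := by ext; simp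
  right_inv _ := by ext; simp

/-- `Z_γ = ∏ Z_e ^ {c_e}`, which multiplies `⨂ l_{k e}` by `∏ ω ^ {c e * k e}`. -/
noncomputable def opZ (c : E → ZMod d) : Hilb E d ≃ₗ[ℂ] Hilb E d where
  toFun ψ := WithLp.toLp 2 fun k => phase d (∑ e, c e * k e) * ψ k
  invFun ψ := WithLp.toLp 2 fun k => phase d (-∑ e, c e * k e) * ψ k
  map_add' _ _ := by ext; simp [mul_add]
  map_smul' _ _ := by ext; simp [mul_left_comm]
  left_inv _ := by ext; simp [← mul_assoc, ← phase_add, phase_zero]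
  right_inv _ := by ext; simp [← mul_assoc, ← phase_add, phase_zero]

theorem opX_add (c c' : E → ZMod d) : opX d (c + c') = opX d c * opX d c' := by
  ext ψ k
  simp [opX, sub_sub]

theorem opZ_add (c c' : E → ZMod d) : opZ d (c + c') = opZ d c * opZ d c' := by
  ext ψ k
  simp [opZ, add_mul, Finset.sum_add_distrib, phase_add, mul_assoc]

/-- On the spin at a single edge, `X l_i = l_{i+1}`. -/
theorem opX_single [DecidableEq E] (e : E) (k : E → ZMod d) :
    opX d (Pi.single e 1) (EuclideanSpace.single k 1) =
      EuclideanSpace.single (k + Pi.single e 1) 1 := by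
  ext m
  simp [opX, sub_eq_iff_eq_add]

/-- On the spin at a single edge, `Z l_i = ω ^ i l_i`. -/
theorem opZ_single [DecidableEq E] (e : E) (k : E → ZMod d) :
    opZ d (Pi.single e 1) (EuclideanSpace.single k 1) =
      (omega d ^ (k e).val) • EuclideanSpace.single k (1 : ℂ) := by
  ext m
  by_cases h : m = k
  · subst h; simp [opZ, Pi.single_apply, phase]
  · simp [opZ, h]

end Operators

namespace PolygonDecomposition

variable {E : Type*} [Fintype E] (G : PolygonDecomposition E) (d : ℕ) [NeZero d]

/-- The product over the edges at `v` of `X_e` (incoming edges) and `X_e⁻¹` (outgoing edges). -/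
noncomputable def opa (v : G.Vertex) : Module.End ℂ (Hilb E d) :=
  (opX d (G.vertexSign (ZMod d) v)).toLinearMap

/-- The product over the edges of `f` of `Z_e` (positively oriented) and `Z_e⁻¹` (negatively). -/
noncomputable def opb (f : G.Face) : Module.End ℂ (Hilb E d) :=
  (opZ d (G.faceSign (ZMod d) f)).toLinearMap

noncomputable def opA (v : G.Vertex) : Module.End ℂ (Hilb E d) :=
  (d : ℂ)⁻¹ • ∑ j ∈ Finset.range d, G.opa d v ^ j

noncomputable def opB (f : G.Face) : Module.End ℂ (Hilb E d) :=
  (d : ℂ)⁻¹ • ∑ j ∈ Finset.range d, G.opb d f ^ j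

noncomputable def hamiltonian : Module.End ℂ (Hilb E d) :=
  -∑ v, G.opA d v - ∑ f, G.opB d f

/-- The smallest eigenvalue of the Hamiltonian. -/
noncomputable def groundEnergy : ℝ :=
  sInf {x : ℝ | (G.hamiltonian d).HasEigenvalue (x : ℂ)}

/-- The ground state space `S_G`. -/
noncomputable def groundSpace : Submodule ℂ (Hilb E d) :=
  (G.hamiltonian d).eigenspace (G.groundEnergy d : ℂ)

/-! ### Excited states and braiding -/

/-- The span of the states `X_{γ*} Z_γ Ψ`, over walks `γ` from `v` to `w` and cowalks `γ*` from `f`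
to `g`. -/
noncomputable def pairSpace (v w : G.Vertex) (f g : G.Face) (Ψ : Hilb E d) :
    Submodule ℂ (Hilb E d) :=
  Submodule.span ℂ
    {φ | ∃ (γ : G.Walk v w) (γs : G.Cowalk f g),
      φ = opX d (γs.chain (ZMod d)) (opZ d (γ.chain (ZMod d)) Ψ)}

/-- The closed walk `τ` at `v`, along which the `Z`-particle at `v` is transported around the
`X`-particle at `f`: it is a boundary and it has just one edge in common with the cowalk `γ*` from
`f` to `g`, where `γ*` crosses it from left to right. The latter says that `τ` encircles `f`
counterclockwise; as dual edges cross edges from right to left, it is expressed by the sign `-1`. -/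
structure IsBraidingLoop {v : G.Vertex} {f g : G.Face} (γs : G.Cowalk f g) (τ : G.Walk v v) :
    Prop where
  isBoundary : τ.chain (ZMod d) ∈ LinearMap.range (G.bdry₂ (ZMod d))
  crossesOnce : ∃ e : E, τ.chain (ZMod d) e * γs.chain (ZMod d) e = -1 ∧
    ∀ e' : E, τ.chain (ZMod d) e' ≠ 0 → γs.chain (ZMod d) e' ≠ 0 → e' = e

/-- The physical braiding: transport of the `Z`-particle along `τ`. -/
noncomputable def braiding {v : G.Vertex} (τ : G.Walk v v) : Hilb E d ≃ₗ[ℂ] Hilb E d :=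
  opZ d (τ.chain (ZMod d))

/-- Elementary cycles `lam`, `tau` that wind once around the torus in the two directions, and
corresponding elementary cocycles `lamS`, `tauS`. They are bases of the integral first homology of
the decomposition and of its dual, a cycle does not cross the parallel cocycle (algebraically), and
the cocycles are oriented so that they cross the transversal cycles in the positive direction. -/
structure ElementaryCycles where
  lam : E → ℤ
  tau : E → ℤ
  lamS : E → ℤ
  tauS : E → ℤ
  lam_cycle : G.bdry₁ ℤ lam = 0
  tau_cycle : G.bdry₁ ℤ tau = 0
  lamS_cocycle : G.cobdry₁ ℤ lamS = 0
  tauS_cocycle : G.cobdry₁ ℤ tauS = 0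
  basis : ∀ c : E → ℤ, G.bdry₁ ℤ c = 0 →
    ∃! m : ℤ × ℤ, c - (m.1 • lam + m.2 • tau) ∈ LinearMap.range (G.bdry₂ ℤ)
  cobasis : ∀ c : E → ℤ, G.cobdry₁ ℤ c = 0 →
    ∃! m : ℤ × ℤ, c - (m.1 • lamS + m.2 • tauS) ∈ LinearMap.range (G.cobdry₂ ℤ)
  lam_lamS : crossing lam lamS = 0
  tau_tauS : crossing tau tauS = 0
  lam_tauS : 0 < crossing lam tauS
  tau_lamS : 0 < crossing tau lamS

variable {G}

/-- The `1`-chain `c` is a cycle with homology class `(α, β)`, i.e. it is homologous modulo `d` to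
`α lam + β tau`. -/
def ElementaryCycles.HasClass (M : G.ElementaryCycles) (c : E → ZMod d) (α β : ZMod d) : Prop :=
  (c - fun e => α * (M.lam e : ZMod d) + β * (M.tau e : ZMod d)) ∈
    LinearMap.range (G.bdry₂ (ZMod d))

/-- The `1`-cochain `c` is a cocycle with cohomology class `(α, β)`. -/
def ElementaryCycles.HasCoclass (M : G.ElementaryCycles) (c : E → ZMod d) (α β : ZMod d) : Prop :=
  (c - fun e => α * (M.lamS e : ZMod d) + β * (M.tauS e : ZMod d)) ∈
    LinearMap.range (G.cobdry₂ (ZMod d))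

end PolygonDecomposition

end Kitaev

namespace Kitaev

/-! ### Incidence of darts -/

/-! Linear algebra over `ZMod d`, with two connected graphs in the background: vertices joined by
edges, and faces joined by dual edges. In a connected graph a cochain is a coboundary iff it has
zero crossing number with every cycle (`IsConnectedGraph.mem_range_dartCobdry_iff`). The boundaries
of faces are the coboundaries of the dual graph, so this one fact tests both boundaries and
coboundaries by crossing numbers.

Each local term of the Hamiltonian is the average of the powers of an isometry, hence a contraction.
The uniform superposition of the coboundaries is fixed by all local terms, so the ground states are
exactly the states fixed by all of them. In the product basis they are the functions supported on
cocycles and invariant under coboundaries (`mem_groundSpace_iff`), i.e. functions on the first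
cohomology modulo `d`. The operators `Z_c` of cycles multiply such functions by characters that
separate classes, and the `X_k` of cocycles translate them. Fourier projection followed by
translation therefore yields every ground state from any nonzero one (`loopSpan_eq_groundSpace`).

Changing a walk or cowalk with fixed ends adds a cycle or a cocycle, and modulo `d` all of these
occur. Since `X` and `Z` operators commute up to phases, irreducibility gives `pairSpace_eq`.

For the braiding, `Z_τ` passes `X_{γ*}` at the cost of the phase of the crossing number `-1`, and
then acts trivially on the ground state because `τ` is a boundary. The commutator of the global
loops gives the same phase: `crossing_tau_lamS` shows that a positive crossing number of integral
bases must be `1`. -/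

theorem flip_flip {E : Type*} (a : Dart E) : flip E (flip E a) = a := by
  rcases a with ⟨e, _ | _⟩ <;> rfl

section Incidence

variable {E A : Type*} (s t : Dart E → A) (R : Type*) [CommRing R]

open Classical in
/-- The incidence number of `x` with the positive dart at `e`: `+1` at its end, `-1` at its
start. -/
noncomputable def incidence (x : A) (e : E) : R :=
  (if t (e, true) = x then 1 else 0) - (if s (e, true) = x then 1 else 0)

/-- The boundary map of the graph with the incidences `s`, `t`. -/
noncomputable def dartBdry [Fintype E] : (E → R) →ₗ[R] (A → R) where
  toFun c := fun x => ∑ e, c e * incidence s t R x e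
  map_add' a b := by ext v; simp [add_mul, Finset.sum_add_distrib]
  map_smul' r a := by ext v; simp [Finset.mul_sum, mul_assoc]

/-- The coboundary map of the graph with the incidences `s`, `t`. -/
noncomputable def dartCobdry [Fintype A] : (A → R) →ₗ[R] (E → R) where
  toFun c := fun e => ∑ x, c x * incidence s t R x e
  map_add' a b := by ext v; simp [add_mul, Finset.sum_add_distrib]
  map_smul' r a := by ext v; simp [Finset.mul_sum, mul_assoc]

variable {s t R}

theorem dartBdry_apply [Fintype E] (c : E → R) (x : A) :
    dartBdry s t R c x = ∑ e, c e * incidence s t R x e := rfl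

theorem dartCobdry_apply [Fintype A] (p : A → R) (e : E) :
    dartCobdry s t R p e = p (t (e, true)) - p (s (e, true)) := by
  classical
  simp [dartCobdry, incidence, mul_sub, Finset.sum_sub_distrib]

open Classical in
theorem dartBdry_single [Fintype E] (e : E) (r : R) :
    dartBdry s t R (Pi.single e r) =
      Pi.single (t (e, true)) r - Pi.single (s (e, true)) r := by
  ext x
  rw [dartBdry_apply, Finset.sum_eq_single e]
  · simp [incidence, mul_sub, Pi.single_apply, eq_comm]
  · intro b _ hb; simp [hb]
  · simp

theorem crossing_add_left [Fintype E] (a b c : E → R) :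
    crossing (a + b) c = crossing a c + crossing b c := by
  simp [crossing, add_mul, Finset.sum_add_distrib]

theorem crossing_comm [Fintype E] (a b : E → R) : crossing a b = crossing b a := by
  simp [crossing, mul_comm]

theorem crossing_add_right [Fintype E] (a b c : E → R) :
    crossing a (b + c) = crossing a b + crossing a c := by
  simp [crossing, mul_add, Finset.sum_add_distrib]

theorem crossing_sub_left [Fintype E] (a b c : E → R) :
    crossing (a - b) c = crossing a c - crossing b c := by
  simp [crossing, sub_mul, Finset.sum_sub_distrib]

theorem crossing_sub_right [Fintype E] (a b c : E → R) :
    crossing a (b - c) = crossing a b - crossing a c := by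
  simp [crossing, mul_sub, Finset.sum_sub_distrib]

theorem crossing_smul_left [Fintype E] (r : R) (a b : E → R) :
    crossing (r • a) b = r * crossing a b := by
  simp [crossing, Finset.mul_sum, mul_assoc]

theorem crossing_smul_right [Fintype E] (r : R) (a b : E → R) :
    crossing a (r • b) = r * crossing a b := by
  simp [crossing, Finset.mul_sum, mul_left_comm]

open Classical in
theorem crossing_single_left [Fintype E] (e : E) (r : R) (k : E → R) :
    crossing (Pi.single e r) k = r * k e := by
  simp [crossing, Pi.single_apply]

/-- The coboundary is the transpose of the boundary for the crossing pairing. -/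
theorem crossing_dartCobdry [Fintype E] [Fintype A] (c : E → R) (p : A → R) :
    crossing c (dartCobdry s t R p) = ∑ x, p x * dartBdry s t R c x := by
  simp only [crossing, dartCobdry, dartBdry, LinearMap.coe_mk, AddHom.coe_mk, Finset.mul_sum]
  rw [Finset.sum_comm]
  refine Finset.sum_congr rfl fun x _ => Finset.sum_congr rfl fun e _ => by ring

end Incidence

/-! ### Walks and their chains -/

namespace DartWalk

variable {E A : Type*} {s t : Dart E → A} (R : Type*) [CommRing R]

def append {x y z : A} : DartWalk s t x y → DartWalk s t y z → DartWalk s t x z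
  | nil _, q => q
  | cons a hs ht p, q => cons a hs ht (p.append q)

theorem chain_append {x y z : A} (p : DartWalk s t x y) (q : DartWalk s t y z) :
    (p.append q).chain R = p.chain R + q.chain R := by
  induction p with
  | nil => simp [append, chain]
  | cons a hs ht p ih => simp [append, chain, ih, add_assoc]

def reverse (h : ∀ a, s (flip E a) = t a) {x y : A} : DartWalk s t x y → DartWalk s t y x
  | nil x => nil x
  | cons a hs ht p => (p.reverse h).append
      (cons (flip E a) ((h a).trans ht) (by rw [← h, flip_flip, hs]) (nil _))

theorem chain_reverse (h : ∀ a, s (flip E a) = t a) {x y : A} (p : DartWalk s t x y) :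
    (p.reverse h).chain R = - p.chain R := by
  classical
  induction p with
  | nil => simp [reverse, chain]
  | cons a hs ht p ih =>
    rcases a with ⟨e, _ | _⟩ <;>
    · simp only [reverse, chain_append, ih, chain, flip, Equiv.prodCongr_apply, Prod.map,
        Equiv.boolNot_apply, Equiv.refl_apply]
      ext e'
      by_cases h' : e' = e
      · subst h'; simp [add_comm]
      · simp [h']

open Classical in
-- The boundary telescopes along the walk.
theorem dartBdry_chain [Fintype E] (h : ∀ a, s (flip E a) = t a) {x y : A}
    (p : DartWalk s t x y) :
    dartBdry s t R (p.chain R) = Pi.single y 1 - Pi.single x 1 := by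
  induction p with
  | nil => simp [chain]
  | @cons x y z a hs ht p ih =>
    rw [chain, map_add, ih]
    convert congrArg (· + (Pi.single z 1 - Pi.single y 1 : A → R))
      (dartBdry_single (s := s) (t := t) a.1 (if a.2 = true then (1 : R) else -1)) using 1
    subst hs ht
    rcases a with ⟨e, _ | _⟩
    -- A step against the orientation swaps start and end and has coefficient `-1`; the two signs
    -- cancel.
    · have h1 : s (e, true) = t (e, false) := h (e, false)
      have h2 : s (e, false) = t (e, true) := h (e, true)
      simp only [h2, ← h1, Bool.false_eq_true, if_false, Pi.single_neg]
      abel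
    · simp

/-- The chains of closed walks form a group. -/
def closedChains (h : ∀ a, s (flip E a) = t a) (x : A) : AddSubgroup (E → R) where
  carrier := {c | ∃ p : DartWalk s t x x, p.chain R = c}
  zero_mem' := ⟨nil x, rfl⟩
  add_mem' := by
    rintro _ _ ⟨p, rfl⟩ ⟨q, rfl⟩
    exact ⟨p.append q, chain_append R p q⟩
  neg_mem' := by
    rintro _ ⟨p, rfl⟩
    exact ⟨p.reverse h, chain_reverse R h p⟩

end DartWalk

/-! ### Cycles of connected graphs -/

theorem finrank_range_add_finrank_ker_int {ι M : Type*} [Fintype ι] [AddCommGroup M]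
    (f : (ι → ℤ) →ₗ[ℤ] M) :
    Module.finrank ℤ (LinearMap.range f) + Module.finrank ℤ (LinearMap.ker f) =
      Fintype.card ι := by
  rw [← f.quotKerEquivRange.finrank_eq, Submodule.finrank_quotient_add_finrank,
    Module.finrank_fintype_fun_eq_card]

/-- A connected graph, given by its darts. -/
structure IsConnectedGraph {E A : Type*} (s t : Dart E → A) : Prop where
  src_flip : ∀ a, s (flip E a) = t a
  nonempty : Nonempty A
  reachable : ∀ x y, Nonempty (DartWalk s t x y)

namespace IsConnectedGraph

variable {E A : Type*} {s t : Dart E → A} (R : Type*) [CommRing R]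

/-- The chain of a path from a base point to `x`. -/
noncomputable def pathChain (h : IsConnectedGraph s t) (x₀ x : A) : E → R :=
  (h.reachable x₀ x).some.chain R

open Classical in
/-- The loop from the base point to the start of `e`, through `e`, and back. -/
noncomputable def loop (h : IsConnectedGraph s t) (x₀ : A) (e : E) : E → R :=
  h.pathChain R x₀ (s (e, true)) + Pi.single e 1 - h.pathChain R x₀ (t (e, true))

theorem loop_mem_closedChains (h : IsConnectedGraph s t) (x₀ : A) (e : E) :
    h.loop R x₀ e ∈ DartWalk.closedChains R h.src_flip x₀ := by
  classical
  refine ⟨((h.reachable x₀ (s (e, true))).some.append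
    (.cons (e, true) rfl rfl (.nil _))).append
      ((h.reachable x₀ (t (e, true))).some.reverse h.src_flip), ?_⟩
  rw [DartWalk.chain_append, DartWalk.chain_append, DartWalk.chain_reverse]
  simp only [DartWalk.chain, loop, pathChain, if_true, add_zero, sub_eq_add_neg]

variable [Fintype E]

theorem dartBdry_loop (h : IsConnectedGraph s t) (x₀ : A) (e : E) :
    dartBdry s t R (h.loop R x₀ e) = 0 := by
  obtain ⟨p, hp⟩ := h.loop_mem_closedChains R x₀ e
  rw [← hp, DartWalk.dartBdry_chain R h.src_flip, sub_self]

variable {R}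

/-- Replacing each edge by its loop adds the path to its start and removes the path to its end.
Grouped by vertex, these corrections have the boundary of `c` as coefficients; so every cycle is a
combination of based loops. -/
theorem sum_smul_loop (h : IsConnectedGraph s t) [Fintype A] (x₀ : A) (c : E → R) :
    ∑ e, c e • h.loop R x₀ e = c - ∑ x, dartBdry s t R c x • h.pathChain R x₀ x := by
  classical
  have h1 : ∑ x, dartBdry s t R c x • h.pathChain R x₀ x =
      ∑ e, c e • (h.pathChain R x₀ (t (e, true)) - h.pathChain R x₀ (s (e, true))) := by
    simp only [dartBdry_apply, Finset.sum_smul]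
    rw [Finset.sum_comm]
    refine Finset.sum_congr rfl fun e _ => ?_
    simp only [incidence, mul_smul, ← Finset.smul_sum, sub_smul, Finset.sum_sub_distrib]
    simp [ite_smul]
  have h2 : ∑ e, c e • (Pi.single e 1 : E → R) = c := by
    ext e'
    simp [Finset.sum_apply, Pi.single_apply]
  rw [h1, eq_sub_iff_add_eq, ← Finset.sum_add_distrib]
  convert h2 using 1
  refine Finset.sum_congr rfl fun e _ => ?_
  rw [← smul_add, loop]
  congr 1
  abel

theorem sum_smul_loop_of_cycle (h : IsConnectedGraph s t) [Fintype A] (x₀ : A) {c : E → R}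
    (hc : dartBdry s t R c = 0) :
    ∑ e, c e • h.loop R x₀ e = c := by
  rw [h.sum_smul_loop, hc]; simp

/-- Modulo `d`, every cycle is run through by a closed walk with any given base point. -/
theorem exists_closedWalk (h : IsConnectedGraph s t) [Fintype A] {d : ℕ} [NeZero d] (x : A)
    {c : E → ZMod d} (hc : dartBdry s t (ZMod d) c = 0) : ∃ p : DartWalk s t x x, p.chain (ZMod d) = c := by
  change c ∈ DartWalk.closedChains (ZMod d) h.src_flip x
  rw [← h.sum_smul_loop_of_cycle x hc]
  refine sum_mem fun e _ => ?_
  -- Coefficients in `ZMod d` are residues of naturals, so scalar multiplication means repeating a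
  -- loop.
  rw [← ZMod.natCast_zmod_val (c e), Nat.cast_smul_eq_nsmul]
  exact nsmul_mem (h.loop_mem_closedChains (ZMod d) x e) _

theorem exists_walk_chain (h : IsConnectedGraph s t) [Fintype A] {d : ℕ} [NeZero d]
    {x y : A} (p : DartWalk s t x y) {c : E → ZMod d} (hc : dartBdry s t (ZMod d) c = 0) :
    ∃ q : DartWalk s t x y, q.chain (ZMod d) = c + p.chain (ZMod d) := by
  obtain ⟨q, rfl⟩ := h.exists_closedWalk x hc
  exact ⟨q.append p, DartWalk.chain_append _ q p⟩

/-- A cochain that is orthogonal to all cycles is a coboundary. -/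
theorem mem_range_dartCobdry (h : IsConnectedGraph s t) [Fintype A] {k : E → R}
    (hk : ∀ c, dartBdry s t R c = 0 → crossing c k = 0) :
    k ∈ LinearMap.range (dartCobdry s t R) := by
  classical
  obtain ⟨x₀⟩ := h.nonempty
  -- The potential at `x` is the crossing number of `k` with a path to `x`; vanishing on the loop
  -- through `e` says that its increment along `e` is `k e`.
  refine ⟨fun x => crossing (h.pathChain R x₀ x) k, ?_⟩
  ext e
  have := hk _ (h.dartBdry_loop R x₀ e)
  rw [loop, crossing_sub_left, crossing_add_left, crossing_single_left, one_mul] at this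
  rw [dartCobdry_apply]
  linear_combination -this

theorem mem_range_dartCobdry_iff (h : IsConnectedGraph s t) [Fintype A] {k : E → R} :
    k ∈ LinearMap.range (dartCobdry s t R) ↔
      ∀ c, dartBdry s t R c = 0 → crossing c k = 0 := by
  refine ⟨?_, h.mem_range_dartCobdry⟩
  rintro ⟨p, rfl⟩ c hc
  simp [crossing_dartCobdry, hc]

/-- By connectedness, the kernel of the coboundary consists of the constants and has rank one. -/
theorem finrank_range_dartCobdry {E : Type*} {s t : Dart E → A} (h : IsConnectedGraph s t)
    [Fintype A] :
    Module.finrank ℤ (LinearMap.range (dartCobdry s t ℤ)) + 1 = Nat.card A := by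
  have hker : LinearMap.ker (dartCobdry s t ℤ) = Submodule.span ℤ {fun _ : A => (1 : ℤ)} := by
    ext p
    rw [LinearMap.mem_ker, Submodule.mem_span_singleton]
    constructor
    · intro hp
      have hstep : ∀ a, p (s a) = p (t a) := by
        have h0 : ∀ e, p (t (e, true)) = p (s (e, true)) := fun e =>
          sub_eq_zero.1 ((dartCobdry_apply p e).symm.trans (congrFun hp e))
        rintro ⟨e, _ | _⟩
        · rw [← h.src_flip, show s (e, false) = t (e, true) from h.src_flip (e, true)]
          exact h0 e
        · exact (h0 e).symm
      have hwalk : ∀ x y, DartWalk s t x y → p x = p y := by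
        intro x y q
        induction q with
        | nil => rfl
        | cons a hs ht q ih => rw [← ih, ← hs, ← ht, hstep]
      obtain ⟨x₀⟩ := h.nonempty
      refine ⟨p x₀, ?_⟩
      ext x
      simpa using hwalk _ _ (h.reachable x₀ x).some
    · rintro ⟨r, rfl⟩
      ext e
      simp [dartCobdry_apply]
  have h1 : Module.finrank ℤ (LinearMap.ker (dartCobdry s t ℤ)) = 1 := by
    rw [hker]
    obtain ⟨x₀⟩ := h.nonempty
    rw [← (LinearEquiv.toSpanNonzeroSingleton ℤ (A → ℤ) (fun _ => 1)
      fun h0 => one_ne_zero (congrFun h0 x₀)).finrank_eq, Module.finrank_self]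
  have h2 := finrank_range_add_finrank_ker_int (dartCobdry s t ℤ)
  rw [h1] at h2
  rw [h2, Nat.card_eq_fintype_card]

/-- The boundaries are precisely the `0`-chains of total weight zero: such a chain is bounded by the
weighted sum of paths from a base point. -/
theorem finrank_range_dartBdry (h : IsConnectedGraph s t) [Fintype A] :
    Module.finrank ℤ (LinearMap.range (dartBdry s t ℤ)) + 1 = Nat.card A := by
  classical
  obtain ⟨x₀⟩ := h.nonempty
  let ε : (A → ℤ) →ₗ[ℤ] ℤ := ∑ x, LinearMap.proj x
  have hε : ∀ p, ε p = ∑ x, p x := fun p => by simp [ε]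
  have hr : LinearMap.range (dartBdry s t ℤ) = LinearMap.ker ε := by
    ext p
    constructor
    · rintro ⟨c, rfl⟩
      rw [LinearMap.mem_ker, hε]
      have : crossing c (dartCobdry s t ℤ fun _ => 1) = 0 := by
        simp [crossing, dartCobdry_apply]
      rw [crossing_dartCobdry] at this
      simpa using this
    · intro hp
      rw [LinearMap.mem_ker, hε] at hp
      refine ⟨∑ x, p x • h.pathChain ℤ x₀ x, ?_⟩
      simp only [map_sum, map_smul, pathChain, DartWalk.dartBdry_chain ℤ h.src_flip, smul_sub,
        Finset.sum_sub_distrib, ← Finset.sum_smul, hp, zero_smul, sub_zero]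
      ext x
      simp [Finset.sum_apply, Pi.single_apply]
  have hs : LinearMap.range ε = ⊤ := by
    rw [LinearMap.range_eq_top]
    intro n
    exact ⟨Pi.single x₀ n, by simp [hε]⟩
  have h2 := finrank_range_add_finrank_ker_int ε
  rw [hs, finrank_top, Module.finrank_self] at h2
  rw [hr, Nat.card_eq_fintype_card, ← h2, add_comm]

end IsConnectedGraph

/-! ### The graphs of a polygon decomposition -/

namespace PolygonDecomposition

variable {E : Type*} (G : PolygonDecomposition E)

theorem src_rotation (a : Dart E) : G.src (G.rotation a) = G.src a :=
  Quotient.sound ((Equiv.Perm.SameCycle.refl _ _).apply_left)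

theorem left_faceRotation (a : Dart E) : G.left (G.faceRotation a) = G.left a :=
  Quotient.sound ((Equiv.Perm.SameCycle.refl _ _).apply_left)

theorem src_faceRotation (a : Dart E) : G.src (G.faceRotation a) = G.tgt a := by
  rw [← G.src_rotation]
  simp [faceRotation, tgt]

theorem left_rotation (a : Dart E) :
    G.left (G.rotation a) = G.right (G.faceRotation⁻¹ a) := by
  rw [right]
  congr 1
  simp [faceRotation, mul_inv_rev]

/-- Transitivity of the group generated by `rotation` and `flip` is used only in this form, to
connect both graphs. -/
theorem connected_induction {r : Dart E → Dart E → Prop} (hr : Equivalence r)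
    (h1 : ∀ a, r a (G.rotation a)) (h2 : ∀ a, r a (flip E a)) (a b : Dart E) : r a b := by
  obtain ⟨⟨π, hπ⟩, hab⟩ := G.connected.exists_smul_eq a b
  have key : ∀ a, r a (π a) := by
    clear hab
    induction hπ using Subgroup.closure_induction with
    | mem x hx =>
      rcases hx with rfl | rfl
      · exact h1
      · exact h2
    | one => exact hr.refl
    | mul x y _ _ hx hy => exact fun a => hr.trans (hy a) (hx (y a))
    | inv x _ hx => exact fun a => hr.symm (by simpa using hx (x⁻¹ a))
  rw [← hab]
  exact key a

theorem walk_isConnectedGraph : IsConnectedGraph G.src G.tgt where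
  src_flip _ := rfl
  nonempty := ⟨G.src (G.nonempty.some, true)⟩
  reachable x y := by
    induction x using Quotient.inductionOn with | _ a
    induction y using Quotient.inductionOn with | _ b
    refine G.connected_induction (r := fun a b => Nonempty (G.Walk (G.src a) (G.src b)))
      ⟨fun a => ⟨.nil _⟩, fun ⟨p⟩ => ⟨p.reverse fun _ => rfl⟩, fun ⟨p⟩ ⟨q⟩ => ⟨p.append q⟩⟩
      (fun a => ?_) (fun a => ?_) a b
    · rw [src_rotation]; exact ⟨.nil _⟩
    · exact ⟨.cons a rfl rfl (.nil _)⟩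

theorem right_flip (a : Dart E) : G.right (flip E a) = G.left a := by
  rw [right, flip_flip]

theorem cowalk_isConnectedGraph : IsConnectedGraph G.right G.left where
  src_flip := G.right_flip
  nonempty := ⟨G.left (G.nonempty.some, true)⟩
  reachable x y := by
    induction x using Quotient.inductionOn with | _ a
    induction y using Quotient.inductionOn with | _ b
    refine G.connected_induction (r := fun a b => Nonempty (G.Cowalk (G.left a) (G.left b)))
      ⟨fun a => ⟨.nil _⟩, fun ⟨p⟩ => ⟨p.reverse G.right_flip⟩, fun ⟨p⟩ ⟨q⟩ => ⟨p.append q⟩⟩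
      (fun a => ?_) (fun a => ?_) a b
    · rw [left_rotation]
      have : G.left a = G.left (G.faceRotation⁻¹ a) := by
        rw [← G.left_faceRotation (G.faceRotation⁻¹ a)]; simp
      rw [this]
      exact ⟨.cons (flip E (G.faceRotation⁻¹ a)) (G.right_flip _) rfl (.nil _)⟩
    · exact ⟨.cons (flip E a) (G.right_flip a) rfl (.nil _)⟩

/-! ### The chain complexes of the decomposition and of its dual -/

section

variable [Fintype E] (R : Type*) [CommRing R]

theorem bdry₁_eq : G.bdry₁ R = dartBdry G.src G.tgt R := rfl

theorem cobdry₁_eq : G.cobdry₁ R = dartBdry G.right G.left R := rfl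

/-- The boundary of a face is a cycle. -/
theorem crossing_faceSign_vertexSign (f : G.Face) (v : G.Vertex) :
    crossing (G.faceSign R f) (G.vertexSign R v) = 0 := by
  classical
  let F : Dart E → R := fun a => if G.left a = f ∧ G.src a = v then 1 else 0
  -- Around a face, the end of a dart is the start of the next one, so reindexing by `faceRotation`
  -- cancels the arrivals at `v` against the departures.
  have h1 : ∑ a, (F (G.faceRotation a) - F a) = 0 := by
    rw [Finset.sum_sub_distrib, Equiv.sum_comp G.faceRotation F, sub_self]
  have h1' : ∑ a : Dart E, ((if G.left a = f ∧ G.tgt a = v then (1 : R) else 0) -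
      if G.left a = f ∧ G.src a = v then 1 else 0) = 0 := by
    simpa only [F, left_faceRotation, src_faceRotation] using h1
  rw [Fintype.sum_prod_type] at h1'
  rw [crossing, ← h1']
  refine Finset.sum_congr rfl fun e _ => ?_
  have e1 : G.left (e, false) = G.right (e, true) := rfl
  have e2 : G.tgt (e, false) = G.src (e, true) := rfl
  have e3 : G.src (e, false) = G.tgt (e, true) := rfl
  simp only [faceSign, vertexSign, Fintype.sum_bool, e1, e2, e3]
  by_cases h1 : G.left (e, true) = f <;> by_cases h2 : G.right (e, true) = f <;>
    by_cases h3 : G.src (e, true) = v <;> by_cases h4 : G.tgt (e, true) = v <;>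
    simp [h1, h2, h3, h4]

variable {R}

theorem bdry₂_eq_sum (p : G.Face → R) : G.bdry₂ R p = ∑ f, p f • G.faceSign R f := by
  ext e; simp [bdry₂, Finset.sum_apply]

theorem cobdry₂_eq_sum (p : G.Vertex → R) : G.cobdry₂ R p = ∑ v, p v • G.vertexSign R v := by
  ext e; simp [cobdry₂, Finset.sum_apply]

theorem cobdry₁_apply (c : E → R) (f : G.Face) :
    G.cobdry₁ R c f = crossing c (G.faceSign R f) := rfl

theorem bdry₁_faceSign (f : G.Face) : G.bdry₁ R (G.faceSign R f) = 0 := by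
  ext v; exact G.crossing_faceSign_vertexSign R f v

theorem cobdry₁_vertexSign (v : G.Vertex) : G.cobdry₁ R (G.vertexSign R v) = 0 := by
  ext f; rw [cobdry₁_apply, crossing_comm]; exact G.crossing_faceSign_vertexSign R f v

theorem bdry₁_bdry₂ (p : G.Face → R) : G.bdry₁ R (G.bdry₂ R p) = 0 := by
  simp [bdry₂_eq_sum, bdry₁_faceSign]

theorem cobdry₁_cobdry₂ (p : G.Vertex → R) : G.cobdry₁ R (G.cobdry₂ R p) = 0 := by
  simp [cobdry₂_eq_sum, cobdry₁_vertexSign]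

/-- The boundaries are the chains that are orthogonal to all cocycles. -/
theorem mem_range_bdry₂_iff {c : E → R} :
    c ∈ LinearMap.range (G.bdry₂ R) ↔ ∀ k, G.cobdry₁ R k = 0 → crossing c k = 0 := by
  simp_rw [crossing_comm c]
  -- By definition `bdry₂` is the coboundary map of the dual graph.
  exact G.cowalk_isConnectedGraph.mem_range_dartCobdry_iff

/-- The coboundaries are the cochains that are orthogonal to all cycles. -/
theorem mem_range_cobdry₂_iff {k : E → R} :
    k ∈ LinearMap.range (G.cobdry₂ R) ↔ ∀ c, G.bdry₁ R c = 0 → crossing c k = 0 :=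
  G.walk_isConnectedGraph.mem_range_dartCobdry_iff

end

end PolygonDecomposition

end Kitaev

namespace Kitaev
namespace PolygonDecomposition

/-! ### Homology and elementary cycles -/

variable {E : Type*} [Fintype E] (G : PolygonDecomposition E)

section Duality

variable (R : Type*) [CommRing R]

/-- The module of cycles. -/
noncomputable def cycles : Submodule R (E → R) := LinearMap.ker (G.bdry₁ R)

/-- The boundaries, among the cycles. -/
noncomputable def boundaries : Submodule R (G.cycles R) :=
  (LinearMap.range (G.bdry₂ R)).submoduleOf (G.cycles R)

/-- First homology. -/
abbrev Homology := G.cycles R ⧸ G.boundaries R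

variable {R}

theorem mem_boundaries {c : G.cycles R} :
    c ∈ G.boundaries R ↔ (c : E → R) ∈ LinearMap.range (G.bdry₂ R) := Iff.rfl

theorem bdry₂_mem_cycles (p : G.Face → R) : G.bdry₂ R p ∈ G.cycles R := G.bdry₁_bdry₂ p

/-- Poincaré duality: every functional on the first homology is the crossing number with a
cocycle. -/
theorem exists_cocycle_of_functional (φ : G.cycles R →ₗ[R] R)
    (hφ : ∀ c ∈ G.boundaries R, φ c = 0) :
    ∃ k, G.cobdry₁ R k = 0 ∧ ∀ c : G.cycles R, crossing (c : E → R) k = φ c := by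
  have h := G.walk_isConnectedGraph
  obtain ⟨x₀⟩ := h.nonempty
  -- The cocycle takes at `e` the value of `φ` on the loop through `e`; this represents `φ` because
  -- the loops recombine to any cycle.
  let l : E → G.cycles R := fun e => ⟨h.loop R x₀ e, h.dartBdry_loop R x₀ e⟩
  have key : ∀ c : G.cycles R, crossing (c : E → R) (fun e => φ (l e)) = φ c := by
    intro c
    have : c = ∑ e, (c : E → R) e • l e := by
      ext1
      rw [AddSubmonoidClass.coe_finsetSum]
      exact (h.sum_smul_loop_of_cycle x₀ c.2).symm
    conv_rhs => rw [this]
    simp [crossing]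
  refine ⟨fun e => φ (l e), ?_, key⟩
  ext f
  rw [cobdry₁_apply, crossing_comm]
  refine (key ⟨G.faceSign R f, G.bdry₁_faceSign f⟩).trans (hφ _ ?_)
  classical
  exact ⟨Pi.single f 1, by simp [bdry₂_eq_sum, Pi.single_apply]⟩

theorem crossing_boundary_cocycle {c k : E → R} (hc : c ∈ LinearMap.range (G.bdry₂ R))
    (hk : G.cobdry₁ R k = 0) : crossing c k = 0 :=
  G.mem_range_bdry₂_iff.1 hc k hk

theorem crossing_cycle_coboundary {c k : E → R} (hc : G.bdry₁ R c = 0)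
    (hk : k ∈ LinearMap.range (G.cobdry₂ R)) : crossing c k = 0 :=
  G.mem_range_cobdry₂_iff.1 hk c hc

end Duality

/-- Boundaries are detected by crossing numbers in `ℤ`, from which a nonzero factor `n` can be
cancelled. -/
theorem isTorsionFree_homology : Module.IsTorsionFree ℤ (G.Homology ℤ) := by
  refine .of_smul_eq_zero fun n x hnx => ?_
  induction x using Submodule.Quotient.induction_on with | _ c
  rw [or_iff_not_imp_left]
  intro hn
  rw [← Submodule.Quotient.mk_smul, Submodule.Quotient.mk_eq_zero, mem_boundaries,
    mem_range_bdry₂_iff] at hnx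
  rw [Submodule.Quotient.mk_eq_zero, mem_boundaries, mem_range_bdry₂_iff]
  intro k hk
  have := hnx k hk
  rw [Submodule.coe_smul, crossing_smul_left] at this
  exact (mul_eq_zero.1 this).resolve_left hn

/-- Cycles have rank `|E| - (|V| - 1)` and boundaries have rank `|F| - 1`; Euler's formula gives the
difference. -/
theorem finrank_homology {g : ℕ} (hG : G.HasGenus g) :
    Module.finrank ℤ (G.Homology ℤ) = 2 * g := by
  have h1 := G.walk_isConnectedGraph.finrank_range_dartBdry
  have h2 := G.cowalk_isConnectedGraph.finrank_range_dartCobdry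
  have h3 := finrank_range_add_finrank_ker_int (dartBdry G.src G.tgt ℤ)
  have h4 : Module.finrank ℤ (G.boundaries ℤ) =
      Module.finrank ℤ (LinearMap.range (dartCobdry G.right G.left ℤ)) := by
    refine (Submodule.submoduleOfEquivOfLe ?_).finrank_eq
    rintro _ ⟨p, rfl⟩
    exact G.bdry₂_mem_cycles p
  have h5 := Submodule.finrank_quotient_add_finrank (G.boundaries ℤ)
  have h6 : Module.finrank ℤ (G.cycles ℤ) =
    Module.finrank ℤ (LinearMap.ker (dartBdry G.src G.tgt ℤ)) := rfl
  unfold HasGenus at hG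
  rw [Nat.card_eq_fintype_card (α := E)] at hG
  change Module.finrank ℤ (G.cycles ℤ ⧸ G.boundaries ℤ) = 2 * g
  omega

/-- Homology is free of rank two. Take representatives of a basis, and as cocycles the Poincaré
duals of the coordinate functionals. -/
theorem nonempty_elementaryCycles (hG : G.HasGenus 1) : Nonempty G.ElementaryCycles := by
  have := G.isTorsionFree_homology
  let b : Module.Basis (Fin 2) ℤ (G.Homology ℤ) :=
    Module.finBasisOfFinrankEq ℤ _ (G.finrank_homology hG)
  have hrep : ∀ x : G.Homology ℤ, ∃ c : G.cycles ℤ, (G.boundaries ℤ).mkQ c = x :=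
    Submodule.mkQ_surjective _
  have hmk : ∀ c : G.cycles ℤ, (G.boundaries ℤ).mkQ c = 0 ↔ c ∈ G.boundaries ℤ := fun _ =>
    Submodule.Quotient.mk_eq_zero _
  choose z hz using fun i => hrep (b i)
  have hcls : ∀ (c : G.cycles ℤ) (m : ℤ × ℤ),
      (c : E → ℤ) - (m.1 • (z 0 : E → ℤ) + m.2 • (z 1 : E → ℤ)) ∈ LinearMap.range (G.bdry₂ ℤ) ↔
      b.repr ((G.boundaries ℤ).mkQ c) 0 = m.1 ∧ b.repr ((G.boundaries ℤ).mkQ c) 1 = m.2 := by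
    intro c m
    have e1 : (c : E → ℤ) - (m.1 • (z 0 : E → ℤ) + m.2 • (z 1 : E → ℤ)) =
      ((c - (m.1 • z 0 + m.2 • z 1) : G.cycles ℤ) : E → ℤ) := by simp
    rw [e1, ← mem_boundaries, ← hmk, map_sub,
      map_add, map_smul, map_smul, hz, hz, ← b.repr.map_eq_zero_iff, Finsupp.ext_iff,
      Fin.forall_fin_two]
    simp [sub_eq_zero]
  have hdual : ∀ i, ∃ k, G.cobdry₁ ℤ k = 0 ∧ ∀ c : G.cycles ℤ,
      crossing (c : E → ℤ) k = b.repr ((G.boundaries ℤ).mkQ c) i := fun i =>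
    G.exists_cocycle_of_functional (b.coord i ∘ₗ (G.boundaries ℤ).mkQ) fun c hc => by
      rw [LinearMap.comp_apply, (hmk c).2 hc, map_zero]
  choose k hk hkc using hdual
  have hpair : ∀ i j, crossing (z i : E → ℤ) (k j) = if i = j then 1 else 0 := by
    intro i j
    rw [hkc, hz, b.repr_self, Finsupp.single_apply]
  exact ⟨{
    lam := z 0
    tau := z 1
    -- The indices are exchanged: `lamS` has to cross `tau` and avoid `lam`, so it is dual to the
    -- second basis element.
    lamS := k 1
    tauS := k 0
    lam_cycle := (z 0).2
    tau_cycle := (z 1).2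
    lamS_cocycle := hk 1
    tauS_cocycle := hk 0
    basis := fun c hc => by
      refine ⟨(b.repr ((G.boundaries ℤ).mkQ ⟨c, hc⟩) 0, b.repr ((G.boundaries ℤ).mkQ ⟨c, hc⟩) 1),
        (hcls ⟨c, hc⟩ _).2 ⟨rfl, rfl⟩, fun m hm => ?_⟩
      have := (hcls ⟨c, hc⟩ m).1 hm
      exact Prod.ext this.1.symm this.2.symm
    cobasis := fun c hc => by
      -- By duality the coordinates of a cocycle are its crossing numbers with `tau` and `lam`.
      refine ⟨(crossing (z 1 : E → ℤ) c, crossing (z 0 : E → ℤ) c), ?_, fun m hm => ?_⟩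
      · refine G.mem_range_cobdry₂_iff.2 ?_
        intro y hy
        have h1 := (hcls ⟨y, hy⟩ (_, _)).2 ⟨rfl, rfl⟩
        have h2 := G.crossing_boundary_cocycle h1 hc
        rw [← hkc, ← hkc] at h2
        simp only [crossing_sub_left, crossing_add_left, crossing_smul_left] at h2
        simp only [crossing_sub_right, crossing_add_right, crossing_smul_right]
        linarith
      · have h0 := G.crossing_cycle_coboundary (z 0).2 hm
        have h1 := G.crossing_cycle_coboundary (z 1).2 hm
        simp only [crossing_sub_right, crossing_add_right, crossing_smul_right, hpair] at h0 h1
        simp at h0 h1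
        ext <;> simp <;> linarith
    lam_lamS := by simp [hpair]
    tau_tauS := by simp [hpair]
    lam_tauS := by simp [hpair]
    tau_lamS := by simp [hpair] }⟩

variable {G}

/-- The crossing numbers of elementary cycles with the transversal cocycles are `1`. -/
theorem ElementaryCycles.crossing_tau_lamS (M : G.ElementaryCycles) :
    crossing M.tau M.lamS = 1 := by
  choose m hm huniq using fun c : G.cycles ℤ => M.basis c c.2
  -- The `tau`-coordinate is represented by a cocycle `k` crossing `tau` once. Expanding `k` in the
  -- cobasis, the `tauS` term does not contribute, so the positive integer `crossing M.tau M.lamS`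
  -- divides `1`.
  let φ : G.cycles ℤ →ₗ[ℤ] ℤ :=
    (AddMonoidHom.mk' (fun c => (m c).2) fun c c' => by
      rw [← Prod.snd_add, ← huniq (c + c') (m c + m c')]
      convert add_mem (hm c) (hm c') using 1
      simp only [Submodule.coe_add, Prod.fst_add, Prod.snd_add, add_smul]
      abel).toIntLinearMap
  obtain ⟨k, hk, hkc⟩ := G.exists_cocycle_of_functional φ fun c hc => by
    change (m c).2 = 0
    rw [← huniq c 0 (by simpa using G.mem_boundaries.1 hc)]
    rfl
  have h1 : crossing M.tau k = 1 := by
    rw [hkc ⟨M.tau, M.tau_cycle⟩]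
    change (m _).2 = 1
    rw [← huniq ⟨M.tau, M.tau_cycle⟩ (0, 1) (by simp)]
  obtain ⟨n, hn, -⟩ := M.cobasis k hk
  have h2 := G.crossing_cycle_coboundary M.tau_cycle hn
  simp only [crossing_sub_right, crossing_add_right, crossing_smul_right, M.tau_tauS, h1] at h2
  refine Int.eq_one_of_dvd_one M.tau_lamS.le ⟨n.1, ?_⟩
  linear_combination h2

theorem intCast_bdry₁ {d : ℕ} (c : E → ℤ) (hc : G.bdry₁ ℤ c = 0) :
    G.bdry₁ (ZMod d) (fun e => (c e : ZMod d)) = 0 := by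
  ext v
  have := congrArg (Int.cast : ℤ → ZMod d) (congrFun hc v)
  simpa [bdry₁, vertexSign] using this

theorem intCast_cobdry₁ {d : ℕ} (c : E → ℤ) (hc : G.cobdry₁ ℤ c = 0) :
    G.cobdry₁ (ZMod d) (fun e => (c e : ZMod d)) = 0 := by
  ext v
  have := congrArg (Int.cast : ℤ → ZMod d) (congrFun hc v)
  simpa [cobdry₁, faceSign] using this

theorem ElementaryCycles.crossing_of_hasClass (M : G.ElementaryCycles) {d : ℕ}
    {c k : E → ZMod d} (hc : M.HasClass d c 0 1) (hk : M.HasCoclass d k 1 0) :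
    crossing c k = 1 := by
  unfold HasClass at hc
  unfold HasCoclass at hk
  simp only [zero_mul, one_mul, zero_add, add_zero] at hc hk
  have hτ := intCast_bdry₁ (d := d) _ M.tau_cycle
  have hl := intCast_cobdry₁ (d := d) _ M.lamS_cocycle
  have h0 : crossing (fun e => (M.tau e : ZMod d)) (fun e => (M.lamS e : ZMod d)) = 1 := by
    have := congrArg (Int.cast : ℤ → ZMod d) M.crossing_tau_lamS
    simpa [crossing] using this
  have h1 := G.crossing_boundary_cocycle hc hl
  have hcyc : G.bdry₁ (ZMod d) c = 0 := by
    obtain ⟨p, hp⟩ := hc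
    have := G.bdry₁_bdry₂ p
    rwa [hp, map_sub, hτ, sub_zero] at this
  have h2 := G.crossing_cycle_coboundary hcyc hk
  rw [crossing_sub_left] at h1
  rw [crossing_sub_right] at h2
  linear_combination h1 + h2 + h0

end PolygonDecomposition
/-! ### Phases and loop operators -/

section Phases

variable {d : ℕ} [NeZero d]

theorem phase_eq_one_iff {a : ZMod d} : phase d a = 1 ↔ a = 0 := by
  have h : IsPrimitiveRoot (omega d) d := Complex.isPrimitiveRoot_exp d (NeZero.ne d)
  refine ⟨fun ha => ?_, fun ha => ha ▸ phase_zero d⟩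
  exact (ZMod.val_eq_zero a).1
    (Nat.eq_zero_of_dvd_of_lt ((h.pow_eq_one_iff_dvd _).1 ha) (ZMod.val_lt a))

theorem norm_phase (a : ZMod d) : ‖phase d a‖ = 1 := by
  rw [phase, norm_pow, Complex.norm_eq_one_of_pow_eq_one (omega_pow_self d) (NeZero.ne d), one_pow]

theorem phase_ne_zero (a : ZMod d) : phase d a ≠ 0 := by
  rw [← norm_ne_zero_iff, norm_phase]; exact one_ne_zero

theorem phase_neg_one : phase d (-1) = (omega d)⁻¹ := by
  have h1 : phase d 1 = omega d := by
    rw [phase, ZMod.val_one_eq_one_mod, ← pow_mod_orderOf,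
      Nat.mod_mod_of_dvd _ (orderOf_dvd_of_pow_eq_one (omega_pow_self d)), pow_mod_orderOf, pow_one]
  rw [← h1]
  refine eq_inv_of_mul_eq_one_left ?_
  rw [← phase_add, neg_add_cancel, phase_zero]

end Phases

section Operators

variable {E : Type*} [Fintype E] {d : ℕ} [NeZero d]

theorem opX_apply {E : Type*} (c : E → ZMod d) (ψ : Hilb E d) (k : E → ZMod d) :
    opX d c ψ k = ψ (k - c) := rfl

theorem opZ_apply (c : E → ZMod d) (ψ : Hilb E d) (k : E → ZMod d) :
    opZ d c ψ k = phase d (crossing c k) * ψ k := rfl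

theorem opX_zero {E : Type*} : opX d (0 : E → ZMod d) = 1 := by
  ext ψ k; simp [opX_apply]

theorem opZ_zero : opZ d (0 : E → ZMod d) = 1 := by
  ext ψ k; simp [opZ_apply, crossing, phase_zero]

/-- The Weyl relation, the source of all phases below. -/
theorem opZ_opX (c k : E → ZMod d) (ψ : Hilb E d) :
    opZ d c (opX d k ψ) = phase d (crossing c k) • opX d k (opZ d c ψ) := by
  ext m
  simp only [opZ_apply, opX_apply, PiLp.smul_apply, smul_eq_mul]
  rw [← mul_assoc, ← phase_add, crossing_sub_right, add_sub_cancel]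

theorem opX_opZ (c k : E → ZMod d) (ψ : Hilb E d) :
    opX d k (opZ d c ψ) = phase d (-crossing c k) • opZ d c (opX d k ψ) := by
  rw [opZ_opX, smul_smul, ← phase_add, neg_add_cancel, phase_zero, one_smul]

theorem commutator_apply (c k : E → ZMod d) (φ : Hilb E d) :
    (opX d k * opZ d c * (opX d k)⁻¹ * (opZ d c)⁻¹) φ = phase d (-crossing c k) • φ := by
  have h : (opX d k * opZ d c * (opX d k)⁻¹ * (opZ d c)⁻¹) φ =
      opX d k (opZ d c ((opX d k)⁻¹ ((opZ d c)⁻¹ φ))) := rfl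
  rw [h, opX_opZ]
  congr 1
  change (opZ d c * (opX d k * (opX d k)⁻¹) * (opZ d c)⁻¹) φ = φ
  simp

theorem norm_opX [DecidableEq E] (c : E → ZMod d) (ψ : Hilb E d) : ‖opX d c ψ‖ = ‖ψ‖ := by
  rw [EuclideanSpace.norm_eq, EuclideanSpace.norm_eq]
  congr 1
  exact Equiv.sum_comp (Equiv.subRight c) fun k => ‖ψ k‖ ^ 2

theorem norm_opZ [DecidableEq E] (c : E → ZMod d) (ψ : Hilb E d) : ‖opZ d c ψ‖ = ‖ψ‖ := by
  rw [EuclideanSpace.norm_eq, EuclideanSpace.norm_eq]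
  simp [opZ_apply, norm_phase]

theorem opX_toLinearMap_pow (c : E → ZMod d) (n : ℕ) :
    (opX d c).toLinearMap ^ n = (opX d (n • c)).toLinearMap := by
  induction n with
  | zero => rw [zero_smul, opX_zero]; rfl
  | succ n ih => rw [pow_succ, ih, succ_nsmul, opX_add]; rfl

theorem opZ_toLinearMap_pow (c : E → ZMod d) (n : ℕ) :
    (opZ d c).toLinearMap ^ n = (opZ d (n • c)).toLinearMap := by
  induction n with
  | zero => rw [zero_smul, opZ_zero]; rfl
  | succ n ih => rw [pow_succ, ih, succ_nsmul, opZ_add]; rfl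

theorem opX_toLinearMap_pow_self (c : E → ZMod d) : (opX d c).toLinearMap ^ d = 1 := by
  rw [opX_toLinearMap_pow, ← Nat.cast_smul_eq_nsmul (ZMod d), ZMod.natCast_self, zero_smul,
    opX_zero]
  rfl

theorem opZ_toLinearMap_pow_self (c : E → ZMod d) : (opZ d c).toLinearMap ^ d = 1 := by
  rw [opZ_toLinearMap_pow, ← Nat.cast_smul_eq_nsmul (ZMod d), ZMod.natCast_self, zero_smul,
    opZ_zero]
  rfl

end Operators

/-! ### Averages of isometries and frustration-free ground states -/

section Average

theorem average_apply_eq_self_iff {H : Type*} [AddCommGroup H] [Module ℂ H] {U : Module.End ℂ H}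
    {d : ℕ} [NeZero d] (hU : U ^ d = 1) (ψ : H) :
    ((d : ℂ)⁻¹ • ∑ j ∈ Finset.range d, U ^ j) ψ = ψ ↔ U ψ = ψ := by
  have hd : (d : ℂ) ≠ 0 := Nat.cast_ne_zero.2 (NeZero.ne d)
  -- Multiplication by `U` shifts the powers cyclically, as `U ^ d = 1`; hence the average lands in
  -- the fixed space of `U`.
  have hinv : U * ((d : ℂ)⁻¹ • ∑ j ∈ Finset.range d, U ^ j) =
      (d : ℂ)⁻¹ • ∑ j ∈ Finset.range d, U ^ j := by
    rw [mul_smul_comm, Finset.mul_sum]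
    congr 1
    have h1 := Finset.sum_range_succ (fun j => U ^ j) d
    have h2 := Finset.sum_range_succ' (fun j => U ^ j) d
    rw [h1, hU, pow_zero] at h2
    simpa [pow_succ'] using (add_right_cancel h2).symm
  constructor
  · intro h
    have := congrArg (fun T => T ψ) hinv
    simpa only [Module.End.mul_apply, h] using this
  · intro h
    have hp : ∀ j : ℕ, (U ^ j) ψ = ψ := by
      intro j
      induction j with
      | zero => rfl
      | succ j ih => rw [pow_succ, Module.End.mul_apply, h, ih]
    simp [LinearMap.sum_apply, hp, ← Nat.cast_smul_eq_nsmul ℂ, smul_smul, hd]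

variable {H : Type*} [NormedAddCommGroup H] [InnerProductSpace ℂ H]

theorem norm_average_apply_le {U : Module.End ℂ H} (d : ℕ) [NeZero d]
    (hU : ∀ ψ, ‖U ψ‖ = ‖ψ‖) (ψ : H) :
    ‖((d : ℂ)⁻¹ • ∑ j ∈ Finset.range d, U ^ j) ψ‖ ≤ ‖ψ‖ := by
  have hd : (d : ℝ) ≠ 0 := Nat.cast_ne_zero.2 (NeZero.ne d)
  have hp : ∀ j : ℕ, ‖(U ^ j) ψ‖ = ‖ψ‖ := by
    intro j
    induction j with
    | zero => rfl
    | succ j ih => rw [pow_succ', Module.End.mul_apply, hU, ih]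
  rw [LinearMap.smul_apply, LinearMap.sum_apply, norm_smul]
  calc ‖(d : ℂ)⁻¹‖ * ‖∑ j ∈ Finset.range d, (U ^ j) ψ‖
      ≤ ‖(d : ℂ)⁻¹‖ * ∑ j ∈ Finset.range d, ‖(U ^ j) ψ‖ := by
        gcongr; exact norm_sum_le _ _
    _ = ‖ψ‖ := by simp [hp, hd]

/-- Equality case of Cauchy–Schwarz: each real part of `⟨ψ, T i⟩` is at most `‖ψ‖ ^ 2`, and the sum
forces equality everywhere, so `‖ψ - T i‖ ^ 2 ≤ 0`. -/
theorem eq_of_sum_eq_card_smul {ι : Type*} [Fintype ι] {T : ι → H} {ψ : H}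
    (hT : ∀ i, ‖T i‖ ≤ ‖ψ‖) (hsum : ∑ i, T i = (Fintype.card ι : ℂ) • ψ) (i : ι) : T i = ψ := by
  have hle : ∀ i ∈ Finset.univ, (inner ℂ ψ (T i)).re ≤ ‖ψ‖ ^ 2 := fun i _ =>
    calc (inner ℂ ψ (T i)).re ≤ ‖ψ‖ * ‖T i‖ := re_inner_le_norm (𝕜 := ℂ) ψ (T i)
      _ ≤ ‖ψ‖ ^ 2 := by rw [sq]; gcongr; exact hT i
  have hs : ∑ i, (inner ℂ ψ (T i)).re = ∑ _i : ι, ‖ψ‖ ^ 2 := by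
    rw [← Complex.re_sum, ← inner_sum, hsum, inner_smul_right, inner_self_eq_norm_sq_to_K]
    simp only [Finset.sum_const, Finset.card_univ, nsmul_eq_mul]
    norm_cast
    rw [← Complex.ofReal_natCast]
    exact Complex.re_ofReal_mul _ ((‖ψ‖ ^ 2 : ℝ) : ℂ)
  have hi := (Finset.sum_eq_sum_iff_of_le hle).1 hs i (Finset.mem_univ i)
  have hn := norm_sub_sq (𝕜 := ℂ) ψ (T i)
  rw [show RCLike.re (inner ℂ ψ (T i)) = ‖ψ‖ ^ 2 from hi] at hn
  have h1 : ‖T i‖ ^ 2 ≤ ‖ψ‖ ^ 2 := by gcongr; exact hT i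
  have h2 : ‖ψ - T i‖ ^ 2 ≤ 0 := by linarith
  have h3 : ‖ψ - T i‖ = 0 := by nlinarith [norm_nonneg (ψ - T i)]
  exact (sub_eq_zero.1 (norm_eq_zero.1 h3)).symm

end Average

/-! ### Ground states as functions on cohomology -/

namespace PolygonDecomposition

variable {E : Type*} [Fintype E] (G : PolygonDecomposition E) {d : ℕ} [NeZero d]

theorem opA_apply_eq_self_iff (v : G.Vertex) (ψ : Hilb E d) :
    G.opA d v ψ = ψ ↔ opX d (G.vertexSign (ZMod d) v) ψ = ψ :=
  average_apply_eq_self_iff (opX_toLinearMap_pow_self _) ψ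

theorem opB_apply_eq_self_iff (f : G.Face) (ψ : Hilb E d) :
    G.opB d f ψ = ψ ↔ opZ d (G.faceSign (ZMod d) f) ψ = ψ :=
  average_apply_eq_self_iff (opZ_toLinearMap_pow_self _) ψ

/-- All the local terms of the Hamiltonian. -/
noncomputable def localTerm (d : ℕ) [NeZero d] : G.Vertex ⊕ G.Face → Module.End ℂ (Hilb E d) :=
  Sum.elim (G.opA d) (G.opB d)

theorem hamiltonian_apply (ψ : Hilb E d) :
    G.hamiltonian d ψ = -∑ i, G.localTerm d i ψ := by
  simp [hamiltonian, localTerm, Fintype.sum_sum_type, LinearMap.sum_apply]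
  abel

theorem norm_localTerm_apply_le [DecidableEq E] (i : G.Vertex ⊕ G.Face) (ψ : Hilb E d) :
    ‖G.localTerm d i ψ‖ ≤ ‖ψ‖ := by
  rcases i with v | f
  · exact norm_average_apply_le d (norm_opX _) ψ
  · exact norm_average_apply_le d (norm_opZ _) ψ

theorem crossing_faceSign {R : Type*} [CommRing R] (k : E → R) (f : G.Face) :
    crossing (G.faceSign R f) k = G.cobdry₁ R k f := by
  rw [cobdry₁_apply, crossing_comm]

/-- The states that are fixed by all `a_v` and `b_f` are the functions on the first cohomology. -/
theorem localTerm_fixed_iff (ψ : Hilb E d) :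
    (∀ i, G.localTerm d i ψ = ψ) ↔
      (∀ k, ψ k ≠ 0 → G.cobdry₁ (ZMod d) k = 0) ∧
        ∀ k, ∀ c ∈ LinearMap.range (G.cobdry₂ (ZMod d)), ψ (k + c) = ψ k := by
  simp only [Sum.forall, localTerm, Sum.elim_inl, Sum.elim_inr, opA_apply_eq_self_iff,
    opB_apply_eq_self_iff]
  rw [and_comm]
  refine and_congr ⟨fun h k hk => ?_, fun h f => ?_⟩ ⟨fun h k c hc => ?_, fun h v => ?_⟩
  · ext f
    have h1 := congrArg (fun φ : Hilb E d => φ k) (h f)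
    simp only [opZ_apply] at h1
    rw [← crossing_faceSign]
    exact phase_eq_one_iff.1 ((mul_eq_right₀ hk).1 h1)
  · ext k
    rw [opZ_apply, crossing_faceSign]
    by_cases hk : ψ k = 0
    · simp [hk]
    · simp [h k hk, phase_zero]
  -- The periods of `ψ` form a group; invariance under the vertex stars, which generate the
  -- coboundaries, is enough.
  · let S : AddSubgroup (E → ZMod d) :=
      { carrier := {c | ∀ k, ψ (k + c) = ψ k}
        zero_mem' := fun k => by simp
        add_mem' := fun {a b} ha hb k => by rw [← add_assoc, hb, ha]
        neg_mem' := fun {a} ha k => by rw [← ha (k + -a), neg_add_cancel_right] }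
    suffices c ∈ S from this k
    obtain ⟨p, rfl⟩ := hc
    rw [cobdry₂_eq_sum]
    refine sum_mem fun v _ => ?_
    rw [← ZMod.natCast_zmod_val (p v), Nat.cast_smul_eq_nsmul]
    refine nsmul_mem (fun k => ?_) _
    have h1 := congrArg (fun φ : Hilb E d => φ (k + G.vertexSign (ZMod d) v)) (h v)
    simpa [opX_apply] using h1.symm
  · ext k
    classical
    rw [opX_apply, ← h (k - G.vertexSign (ZMod d) v) (G.vertexSign (ZMod d) v)
      ⟨Pi.single v 1, by simp [cobdry₂_eq_sum, Pi.single_apply]⟩, sub_add_cancel]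

open Classical in
/-- The uniform superposition over a cohomology class. -/
noncomputable def classState (d : ℕ) [NeZero d] (k₀ : E → ZMod d) : Hilb E d :=
  WithLp.toLp 2 fun k => if k - k₀ ∈ LinearMap.range (G.cobdry₂ (ZMod d)) then 1 else 0

open Classical in
theorem classState_apply (k₀ k : E → ZMod d) : G.classState d k₀ k =
    if k - k₀ ∈ LinearMap.range (G.cobdry₂ (ZMod d)) then 1 else 0 := rfl

theorem localTerm_classState {k₀ : E → ZMod d} (hk₀ : G.cobdry₁ (ZMod d) k₀ = 0) :
    ∀ i, G.localTerm d i (G.classState d k₀) = G.classState d k₀ := by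
  classical
  rw [localTerm_fixed_iff]
  constructor
  · intro k hk
    rw [classState_apply, ne_eq, ite_eq_right_iff, Classical.not_imp] at hk
    obtain ⟨⟨p, hp⟩, -⟩ := hk
    have := G.cobdry₁_cobdry₂ p
    rwa [hp, map_sub, hk₀, sub_zero] at this
  · intro k c hc
    rw [classState_apply, classState_apply, add_sub_right_comm, Submodule.add_mem_iff_left _ hc]

theorem classState_ne_zero (k₀ : E → ZMod d) : G.classState d k₀ ≠ 0 := by
  classical
  intro h
  have := congrArg (fun φ : Hilb E d => φ k₀) h
  simp [classState_apply] at this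

/-- The superposition of the coboundaries attains the value, and no eigenvalue lies lower because
the local terms are contractions. -/
theorem groundEnergy_eq :
    G.groundEnergy d = -(Fintype.card (G.Vertex ⊕ G.Face) : ℝ) := by
  classical
  refine IsLeast.csInf_eq ⟨?_, ?_⟩
  · refine Module.End.hasEigenvalue_of_hasEigenvector (x := G.classState d 0)
      ⟨Module.End.mem_eigenspace_iff.2 ?_, G.classState_ne_zero 0⟩
    rw [hamiltonian_apply, Finset.sum_congr rfl fun i _ =>
      G.localTerm_classState (d := d) (map_zero _) i]
    simp only [Finset.sum_const, Finset.card_univ, ← Nat.cast_smul_eq_nsmul ℂ, ← neg_smul]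
    push_cast
    rfl
  · intro x hx
    obtain ⟨ψ, hψ, hψ0⟩ := hx.exists_hasEigenvector
    rw [Module.End.mem_eigenspace_iff, hamiltonian_apply] at hψ
    have h1 : ‖∑ i, G.localTerm d i ψ‖ ≤ Fintype.card (G.Vertex ⊕ G.Face) * ‖ψ‖ := by
      refine (norm_sum_le _ _).trans ?_
      refine (Finset.sum_le_sum fun i _ => G.norm_localTerm_apply_le i ψ).trans ?_
      simp
    rw [← norm_neg, hψ, norm_smul, Complex.norm_real] at h1
    have h2 := le_of_mul_le_mul_right h1 (norm_pos_iff.2 hψ0)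
    exact neg_le_of_abs_le h2

theorem mem_groundSpace_iff_localTerm (ψ : Hilb E d) :
    ψ ∈ G.groundSpace d ↔ ∀ i, G.localTerm d i ψ = ψ := by
  classical
  rw [groundSpace, Module.End.mem_eigenspace_iff, hamiltonian_apply, groundEnergy_eq]
  push_cast
  rw [neg_smul, neg_inj]
  constructor
  · exact fun h i => eq_of_sum_eq_card_smul (T := fun i => G.localTerm d i ψ)
      (fun i => G.norm_localTerm_apply_le i ψ)
      (by simpa using h) i
  · intro h
    rw [Finset.sum_congr rfl fun i _ => h i]
    simp [← Nat.cast_smul_eq_nsmul ℂ]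

theorem mem_groundSpace_iff (ψ : Hilb E d) :
    ψ ∈ G.groundSpace d ↔
      (∀ k, ψ k ≠ 0 → G.cobdry₁ (ZMod d) k = 0) ∧
        ∀ k, ∀ c ∈ LinearMap.range (G.cobdry₂ (ZMod d)), ψ (k + c) = ψ k :=
  (G.mem_groundSpace_iff_localTerm ψ).trans (G.localTerm_fixed_iff ψ)

variable {G}

theorem opX_mem_groundSpace {ψ : Hilb E d} (hψ : ψ ∈ G.groundSpace d) {k : E → ZMod d}
    (hk : G.cobdry₁ (ZMod d) k = 0) : opX d k ψ ∈ G.groundSpace d := by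
  rw [mem_groundSpace_iff] at hψ ⊢
  refine ⟨fun m hm => ?_, fun m c hc => ?_⟩
  · have := hψ.1 _ hm
    rwa [map_sub, hk, sub_zero] at this
  · rw [opX_apply, opX_apply, add_sub_right_comm, hψ.2 _ c hc]

theorem opZ_mem_groundSpace {ψ : Hilb E d} (hψ : ψ ∈ G.groundSpace d) {c : E → ZMod d}
    (hc : G.bdry₁ (ZMod d) c = 0) : opZ d c ψ ∈ G.groundSpace d := by
  rw [mem_groundSpace_iff] at hψ ⊢
  refine ⟨fun m hm => hψ.1 m (right_ne_zero_of_mul hm), fun m k hk => ?_⟩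
  rw [opZ_apply, opZ_apply, hψ.2 _ k hk, crossing_add_right, G.crossing_cycle_coboundary hc hk,
    add_zero]

/-- Contractible loops act trivially on the ground states. -/
theorem opZ_boundary_apply {ψ : Hilb E d} (hψ : ψ ∈ G.groundSpace d) {c : E → ZMod d}
    (hc : c ∈ LinearMap.range (G.bdry₂ (ZMod d))) : opZ d c ψ = ψ := by
  rw [mem_groundSpace_iff] at hψ
  ext k
  rw [opZ_apply]
  by_cases hk : ψ k = 0
  · simp [hk]
  · rw [G.crossing_boundary_cocycle hc (hψ.1 k hk), phase_zero, one_mul]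

/-! ### Irreducibility of the algebra of loop operators -/

variable (G) in
/-- The span of the images of a state under the loop operators. -/
noncomputable def loopSpan (d : ℕ) [NeZero d] (Ψ : Hilb E d) : Submodule ℂ (Hilb E d) :=
  Submodule.span ℂ {φ | ∃ c k : E → ZMod d, G.bdry₁ (ZMod d) c = 0 ∧ G.cobdry₁ (ZMod d) k = 0 ∧
    φ = opX d k (opZ d c Ψ)}

/-- Orthogonality of characters: some cycle crosses `k` nontrivially, and translating the sum by it
multiplies the sum by a phase other than `1`. -/
theorem sum_phase_cycles [Fintype (LinearMap.ker (G.bdry₁ (ZMod d)))] (k : E → ZMod d)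
    (hk : k ∉ LinearMap.range (G.cobdry₂ (ZMod d))) :
    ∑ c : LinearMap.ker (G.bdry₁ (ZMod d)), phase d (crossing (c : E → ZMod d) k) = 0 := by
  rw [mem_range_cobdry₂_iff] at hk
  push Not at hk
  obtain ⟨c₀, hc₀, hne⟩ := hk
  have h1 : phase d (crossing c₀ k) *
      ∑ c : LinearMap.ker (G.bdry₁ (ZMod d)), phase d (crossing (c : E → ZMod d) k) =
      ∑ c : LinearMap.ker (G.bdry₁ (ZMod d)), phase d (crossing (c : E → ZMod d) k) := by
    rw [Finset.mul_sum, ← Equiv.sum_comp (Equiv.addLeft (⟨c₀, hc₀⟩ : LinearMap.ker _))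
      fun c => phase d (crossing (c : E → ZMod d) k)]
    refine Finset.sum_congr rfl fun c _ => ?_
    rw [← phase_add, Equiv.coe_addLeft, Submodule.coe_add, crossing_add_left]
  by_contra h0
  exact hne (phase_eq_one_iff.1 ((mul_eq_right₀ h0).1 h1))

theorem opX_mem_loopSpan {Ψ φ : Hilb E d} (hφ : φ ∈ G.loopSpan d Ψ) {k : E → ZMod d}
    (hk : G.cobdry₁ (ZMod d) k = 0) : opX d k φ ∈ G.loopSpan d Ψ := by
  induction hφ using Submodule.span_induction with
  | mem φ h =>
    obtain ⟨c, k', hc, hk', rfl⟩ := h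
    refine Submodule.subset_span ⟨c, k + k', hc, by rw [map_add, hk, hk', add_zero], ?_⟩
    rw [opX_add]
    rfl
  | zero => rw [map_zero]; exact zero_mem _
  | add x y _ _ hx hy => rw [map_add]; exact add_mem hx hy
  | smul a x _ hx => rw [map_smul]; exact Submodule.smul_mem _ a hx

theorem classState_mem_loopSpan {Ψ : Hilb E d} (hΨ : Ψ ∈ G.groundSpace d) {k₀ : E → ZMod d}
    (hk₀ : Ψ k₀ ≠ 0) : G.classState d k₀ ∈ G.loopSpan d Ψ := by
  classical
  rw [mem_groundSpace_iff] at hΨ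
  let _ : Fintype (LinearMap.ker (G.bdry₁ (ZMod d))) := Fintype.ofFinite _
  let N : ℂ := Fintype.card (LinearMap.ker (G.bdry₁ (ZMod d)))
  have hN : N ≠ 0 := Nat.cast_ne_zero.2 Fintype.card_ne_zero
  -- Fourier projection of `Ψ` onto the class of `k₀`, on which `Ψ` is constant.
  have key : ∑ c : LinearMap.ker (G.bdry₁ (ZMod d)),
      phase d (-crossing (c : E → ZMod d) k₀) • opZ d (c : E → ZMod d) Ψ =
      (N * Ψ k₀) • G.classState d k₀ := by
    ext k
    simp only [WithLp.ofLp_sum, WithLp.ofLp_smul, Finset.sum_apply, Pi.smul_apply, smul_eq_mul,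
      opZ_apply, classState_apply, ← mul_assoc, ← phase_add, neg_add_eq_sub, ← crossing_sub_right]
    rw [← Finset.sum_mul]
    split_ifs with h
    · have h1 : Ψ k = Ψ k₀ := by rw [← hΨ.2 k₀ _ h, add_sub_cancel]
      rw [h1, mul_one]
      congr 1
      rw [Finset.sum_congr rfl fun c _ => by
        rw [G.crossing_cycle_coboundary (LinearMap.mem_ker.1 c.2) h, phase_zero]]
      simp [N]
    · rw [sum_phase_cycles _ h]; simp
  have hmem : (N * Ψ k₀) • G.classState d k₀ ∈ G.loopSpan d Ψ := by
    rw [← key]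
    refine sum_mem fun c _ => Submodule.smul_mem _ _ (Submodule.subset_span
      ⟨c, 0, LinearMap.mem_ker.1 c.2, map_zero _, ?_⟩)
    rw [opX_zero]
    rfl
  exact (Submodule.smul_mem_iff _ (mul_ne_zero hN hk₀)).1 hmem

theorem opX_classState (k k₀ : E → ZMod d) :
    opX d k (G.classState d k₀) = G.classState d (k₀ + k) := by
  classical
  ext m
  rw [opX_apply, classState_apply, classState_apply, sub_sub, add_comm k]

/-- The loop operators act irreducibly on the ground state space. -/
theorem loopSpan_eq_groundSpace {Ψ : Hilb E d} (hΨ : Ψ ∈ G.groundSpace d) (hΨ0 : Ψ ≠ 0) :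
    G.loopSpan d Ψ = G.groundSpace d := by
  classical
  refine le_antisymm (Submodule.span_le.2 ?_) fun φ hφ => ?_
  · rintro _ ⟨c, k, hc, hk, rfl⟩
    exact opX_mem_groundSpace (opZ_mem_groundSpace hΨ hc) hk
  · obtain ⟨k₀, hk₀⟩ : ∃ k₀, Ψ k₀ ≠ 0 := by
      by_contra! h
      exact hΨ0 (by ext k; exact h k)
    have hcoc := ((G.mem_groundSpace_iff Ψ).1 hΨ).1 k₀ hk₀
    -- Since `k₀` is a cocycle, translation by `k - k₀` moves its class state to that of any other
    -- cocycle.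
    have hall : ∀ k, G.cobdry₁ (ZMod d) k = 0 → G.classState d k ∈ G.loopSpan d Ψ := by
      intro k hk
      have := opX_mem_loopSpan (classState_mem_loopSpan hΨ hk₀) (k := k - k₀)
        (by rw [map_sub, hk, hcoc, sub_zero])
      rwa [opX_classState, add_sub_cancel] at this
    rw [mem_groundSpace_iff] at hφ
    let B := LinearMap.range (G.cobdry₂ (ZMod d))
    let N : ℂ := Fintype.card B
    have hN : N ≠ 0 := Nat.cast_ne_zero.2 Fintype.card_ne_zero
    -- At `m` the contributing `k = m - c` differ from `m` by a coboundary; there are `N` of them,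
    -- all with `φ k = φ m`.
    have key : ∑ k, φ k • G.classState d k = N • φ := by
      ext m
      simp only [WithLp.ofLp_sum, WithLp.ofLp_smul, Finset.sum_apply, Pi.smul_apply, smul_eq_mul,
        classState_apply, mul_ite, mul_one, mul_zero]
      rw [← Equiv.sum_comp (Equiv.subLeft m)]
      simp only [Equiv.subLeft_apply, sub_sub_cancel]
      rw [← Finset.sum_filter, Finset.sum_congr rfl (g := fun _ => φ m)]
      · rw [Finset.sum_const, nsmul_eq_mul, ← Fintype.card_subtype]
      · intro c hc
        rw [← hφ.2 (m - c) c (Finset.mem_filter.1 hc).2, sub_add_cancel]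
    rw [← Submodule.smul_mem_iff _ hN, ← key]
    refine sum_mem fun k _ => ?_
    by_cases hk : φ k = 0
    · rw [hk, zero_smul]; exact zero_mem _
    · exact Submodule.smul_mem _ _ (hall k (hφ.1 k hk))

end PolygonDecomposition
/-! ### Excited states and braiding -/

/-- A step visits both ends of its edge, so an edge touching an unvisited `z` is never used. -/
theorem DartWalk.chain_apply_eq_zero {E A : Type*} {s t : Dart E → A} (R : Type*) [CommRing R]
    (h : ∀ a, s (flip E a) = t a) {x y : A} (p : DartWalk s t x y) (z : A) (hz : z ∉ p.support)
    (e : E) (he : s (e, true) = z ∨ t (e, true) = z) : p.chain R e = 0 := by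
  classical
  have hsupp : ∀ {x y : A} (p : DartWalk s t x y), x ∈ p.support := by
    intro x y p
    cases p <;> simp [support]
  induction p with
  | nil => rfl
  | @cons x y w a hs ht p ih =>
    rw [support, List.mem_cons, not_or] at hz
    have hne : e ≠ a.1 := by
      rintro rfl
      have hy : z ≠ y := fun h' => hz.2 (h' ▸ hsupp p)
      rcases a with ⟨e, _ | _⟩
      · have h1 : s (e, true) = y := (h (e, false)).trans ht
        have h2 : t (e, true) = x := (h (e, true)).symm.trans hs
        rcases he with he | he
        · exact hy (he.symm.trans h1)
        · exact hz.1 (he.symm.trans h2)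
      · rcases he with he | he
        · exact hz.1 (he.symm.trans hs)
        · exact hy (he.symm.trans ht)
    simp [chain, ih hz.2, hne]

namespace PolygonDecomposition

variable {E : Type*} [Fintype E] {G : PolygonDecomposition E} {d : ℕ} [NeZero d]

theorem left_ne_right {E : Type*} {G : PolygonDecomposition E} (e : E) :
    G.left (e, true) ≠ G.right (e, true) := fun h =>
  G.sides_ne e (Quotient.exact h)

/-- The boundary of the initial face crosses a self-avoiding cowalk once. -/
theorem faceSign_crosses_once {E : Type*} {G : PolygonDecomposition E} {R : Type*} [CommRing R]
    {f g : G.Face} (hfg : f ≠ g) (γs : G.Cowalk f g) (hγ : γs.support.Nodup) :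
    ∃ e : E, G.faceSign R f e * γs.chain R e = -1 ∧
      ∀ e' : E, G.faceSign R f e' ≠ 0 → γs.chain R e' ≠ 0 → e' = e := by
  classical
  cases γs with
  | nil => exact absurd rfl hfg
  | @cons _ y _ a hs ht p =>
    rw [DartWalk.support, List.nodup_cons] at hγ
    have h0 := p.chain_apply_eq_zero R G.right_flip f hγ.1
    refine ⟨a.1, ?_, fun e' h1 h2 => ?_⟩
    · rcases a with ⟨e, _ | _⟩
      · have hl : G.left (e, true) = f := hs
        have hr : G.right (e, true) ≠ f := fun h => left_ne_right e (hl.trans h.symm)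
        simp [DartWalk.chain, h0 e (.inr hl), faceSign, hl, hr]
      · have hr : G.right (e, true) = f := hs
        have hl : G.left (e, true) ≠ f := fun h => left_ne_right e (h.trans hr.symm)
        simp [DartWalk.chain, h0 e (.inl hr), faceSign, hl, hr]
    · by_contra hne
      refine h2 ?_
      rw [DartWalk.chain, Pi.add_apply, Pi.single_eq_of_ne hne, zero_add]
      refine h0 e' ?_
      by_contra! hcon
      exact h1 (by simp [faceSign, hcon.1, hcon.2])

/-- The boundary of `f` is a cycle, hence modulo `d` the chain of a closed walk based at `v`, even
if `v` is far from `f`. -/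
theorem exists_isBraidingLoop (v : G.Vertex) {f g : G.Face} (hfg : f ≠ g) (γs : G.Cowalk f g)
    (hγ : γs.support.Nodup) : ∃ τ : G.Walk v v, G.IsBraidingLoop d γs τ := by
  classical
  obtain ⟨τ, hτ⟩ := G.walk_isConnectedGraph.exists_closedWalk v
    (G.bdry₁_faceSign (R := ZMod d) f)
  refine ⟨τ, ⟨Pi.single f 1, ?_⟩, ?_⟩
  · rw [hτ]; simp [bdry₂_eq_sum, Pi.single_apply]
  · rw [hτ]; exact faceSign_crosses_once hfg γs hγ

theorem pairSpace_eq {v w : G.Vertex} {f g : G.Face} {Ψ : Hilb E d} (hΨ : Ψ ∈ G.groundSpace d)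
    (hΨ0 : Ψ ≠ 0) (γ : G.Walk v w) (γs : G.Cowalk f g) :
    G.pairSpace d v w f g Ψ =
      (G.groundSpace d).map
        (opX d (γs.chain (ZMod d)) * opZ d (γ.chain (ZMod d))).toLinearMap := by
  -- Loop operators are absorbed into the strings up to a nonzero phase, which spans do not see.
  have hmap : ∀ c k : E → ZMod d,
      (opX d (γs.chain (ZMod d)) * opZ d (γ.chain (ZMod d))).toLinearMap (opX d k (opZ d c Ψ)) =
      phase d (crossing (γ.chain (ZMod d)) k) •
        opX d (k + γs.chain (ZMod d)) (opZ d (c + γ.chain (ZMod d)) Ψ) := by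
    intro c k
    rw [add_comm k, add_comm c, opX_add, opZ_add]
    change opX d _ (opZ d _ (opX d k _)) = _
    rw [opZ_opX, map_smul]
    rfl
  refine le_antisymm (Submodule.span_le.2 ?_) ?_
  · rintro _ ⟨γ', γs', rfl⟩
    have hc : G.bdry₁ (ZMod d) (γ'.chain (ZMod d) - γ.chain (ZMod d)) = 0 := by
      rw [map_sub, bdry₁_eq, DartWalk.dartBdry_chain _ G.walk_isConnectedGraph.src_flip,
        DartWalk.dartBdry_chain _ G.walk_isConnectedGraph.src_flip, sub_self]
    have hk : G.cobdry₁ (ZMod d) (γs'.chain (ZMod d) - γs.chain (ZMod d)) = 0 := by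
      rw [map_sub, cobdry₁_eq, DartWalk.dartBdry_chain _ G.right_flip,
        DartWalk.dartBdry_chain _ G.right_flip, sub_self]
    have h1 := Submodule.mem_map_of_mem
      (f := (opX d (γs.chain (ZMod d)) * opZ d (γ.chain (ZMod d))).toLinearMap)
      (opX_mem_groundSpace (opZ_mem_groundSpace hΨ hc) hk)
    rw [hmap, sub_add_cancel, sub_add_cancel, Submodule.smul_mem_iff _ (phase_ne_zero _)] at h1
    exact h1
  · rw [← loopSpan_eq_groundSpace hΨ hΨ0, loopSpan, Submodule.map_span_le]
    rintro _ ⟨c, k, hc, hk, rfl⟩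
    rw [hmap]
    obtain ⟨γ', hγ'⟩ := G.walk_isConnectedGraph.exists_walk_chain γ hc
    obtain ⟨γs', hγs'⟩ := G.cowalk_isConnectedGraph.exists_walk_chain γs hk
    refine Submodule.smul_mem _ _ (Submodule.subset_span ⟨γ', γs', ?_⟩)
    rw [hγ', hγs']

theorem IsBraidingLoop.crossing_eq {v : G.Vertex} {f g : G.Face} {γs : G.Cowalk f g}
    {τ : G.Walk v v} (h : G.IsBraidingLoop d γs τ) :
    crossing (τ.chain (ZMod d)) (γs.chain (ZMod d)) = -1 := by
  obtain ⟨e, he, huniq⟩ := h.crossesOnce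
  rw [crossing, Finset.sum_eq_single e, he]
  · intro e' _ hne
    by_contra h0
    exact hne (huniq e' (left_ne_zero_of_mul h0) (right_ne_zero_of_mul h0))
  · simp

/-- `Z_τ` picks up its phase in passing `X_{γ*}`, commutes with `Z_γ`, and fixes the underlying
ground state since `τ` is a boundary. -/
theorem IsBraidingLoop.braiding_apply {v w : G.Vertex} {f g : G.Face} {γs : G.Cowalk f g}
    {τ : G.Walk v v} (h : G.IsBraidingLoop d γs τ) {Ψ : Hilb E d} (hΨ : Ψ ∈ G.groundSpace d)
    (hΨ0 : Ψ ≠ 0) {φ : Hilb E d} (hφ : φ ∈ G.pairSpace d v w f g Ψ) :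
    G.braiding d τ φ = phase d (-1) • φ := by
  obtain ⟨γ⟩ := G.walk_isConnectedGraph.reachable v w
  rw [pairSpace_eq hΨ hΨ0 γ γs] at hφ
  obtain ⟨ψ, hψ, rfl⟩ := hφ
  change opZ d (τ.chain _) (opX d (γs.chain _) (opZ d (γ.chain _) ψ)) =
    phase d (-1) • opX d (γs.chain _) (opZ d (γ.chain _) ψ)
  rw [opZ_opX, h.crossing_eq]
  congr 2
  change (opZ d (τ.chain _) * opZ d (γ.chain _)) ψ = _
  rw [← opZ_add, add_comm, opZ_add]
  change opZ d (γ.chain _) (opZ d (τ.chain _) ψ) = _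
  rw [opZ_boundary_apply hψ h.isBoundary]

end PolygonDecomposition

end Kitaev

theorem mainTheorem2 {E : Type*} [Fintype E] (G : Kitaev.PolygonDecomposition E)
    (hG : G.HasGenus 1) (d : ℕ) [NeZero d]
    (v w : G.Vertex) (f g : G.Face) (hvw : v ≠ w) (hfg : f ≠ g)
    (Ψ : Kitaev.Hilb E d) (hΨ : Ψ ∈ G.groundSpace d) (hΨ0 : Ψ ≠ 0) :
    -- the space of the excited states is the image of the ground state space
    (∀ (γ : G.Walk v w) (γs : G.Cowalk f g),
      G.pairSpace d v w f g Ψ =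
        (G.groundSpace d).map
          (Kitaev.opX d (γs.chain (ZMod d)) * Kitaev.opZ d (γ.chain (ZMod d))).toLinearMap) ∧
    Module.finrank ℂ (G.pairSpace d v w f g Ψ) = Module.finrank ℂ (G.groundSpace d) ∧
    (∀ Ψ' ∈ G.groundSpace d, Ψ' ≠ 0 →
      G.pairSpace d v w f g Ψ' = G.pairSpace d v w f g Ψ) ∧
    -- braiding loops and elementary (co)cycles exist
    (∀ γs : G.Cowalk f g, γs.support.Nodup → ∃ τ : G.Walk v v, G.IsBraidingLoop d γs τ) ∧
    Nonempty G.ElementaryCycles ∧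
    -- the braiding is the commutator of the global loop operators, and is a phase
    (∀ (γs : G.Cowalk f g) (τ : G.Walk v v), G.IsBraidingLoop d γs τ →
      ∀ φ ∈ G.pairSpace d v w f g Ψ,
        (∀ (M : G.ElementaryCycles) (c cs : E → ZMod d), M.HasClass d c 0 1 →
          M.HasCoclass d cs 1 0 →
          G.braiding d τ φ =
            (Kitaev.opX d cs * Kitaev.opZ d c * (Kitaev.opX d cs)⁻¹ * (Kitaev.opZ d c)⁻¹) φ) ∧
        G.braiding d τ φ = (Kitaev.omega d)⁻¹ • φ) := by
  have hpair := fun (γ : G.Walk v w) (γs : G.Cowalk f g) =>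
    Kitaev.PolygonDecomposition.pairSpace_eq hΨ hΨ0 γ γs
  obtain ⟨γ₀⟩ := G.walk_isConnectedGraph.reachable v w
  obtain ⟨γs₀⟩ := G.cowalk_isConnectedGraph.reachable f g
  refine ⟨hpair, ?_, fun Ψ' hΨ' hΨ'0 => ?_, fun γs hγs => ?_, G.nonempty_elementaryCycles hG,
    fun γs τ hτ φ hφ => ⟨fun M c cs hc hcs => ?_, ?_⟩⟩
  · rw [hpair γ₀ γs₀]
    exact LinearEquiv.finrank_map_eq _ _
  · rw [hpair γ₀ γs₀, Kitaev.PolygonDecomposition.pairSpace_eq hΨ' hΨ'0 γ₀ γs₀]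
  · exact Kitaev.PolygonDecomposition.exists_isBraidingLoop v hfg γs hγs
  · rw [hτ.braiding_apply hΨ hΨ0 hφ, Kitaev.commutator_apply, M.crossing_of_hasClass hc hcs]
  · rw [hτ.braiding_apply hΨ hΨ0 hφ, Kitaev.phase_neg_one]
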